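/- Let $G$ be a (finite-dimensional, real, smooth) Lie group with Lie algebra $\mathfrak g=T_eG$, and write $L_g,R_g$ for the maps on bivectors induced by left and right translation by $g$, $\operatorname{Ad}$ and $\operatorname{ad}$ for the actions of $G$ and $\mathfrak g$ on $\wedge^2\mathfrak g$. Let $\pi$ be a Poisson–Lie structure on $G$, i.e. a Poisson 2-tensor with $\pi(gh)=L_g\pi(h)+R_h\pi(g)$ for all $g,h\in G$, and suppose that $\pi$ is given by an $r$-matrix $r\in\mathfrak g\wedge\mathfrak g$: $\pi(g)=L_g r-R_g r$ for all $g\in G$. For $\sigma\in G$ let $\pi_\sigma$ be the right translate of $\pi$, $\pi_\sigma(g)=R_\sigma(\pi(g\sigma^{-1}))$. A closed subgroup $H\subset G$ with Lie algebra $\mathfrak h$ is called coisotropic with respect to a bivector field $\rho$ on $G$ if $\rho(gh)-R_h(\rho(g))\in L_{gh}(\mathfrak h\wedge\mathfrak g)$ for all $g\in G$, $h\in H$, where $\mathfrak h\wedge\mathfrak g\subset\wedge^2\mathfrak g$ is the span of all $u\wedge v$ with $u\in\mathfrak h$, $v\in\mathfrak g$. Let $H$ be a closed subgroup of $G$ that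 is coisotropic with respect to $\pi$, and let $\sigma\in G$. If $H$ is coisotropic with respect to $\pi_\sigma$, then $$\operatorname{ad}_X(\operatorname{Ad}_{\sigma^{-1}}r)\in\mathfrak h\wedge\mathfrak g\quad\text{for all }X\in\mathfrak h .$$ If moreover $H$ is connected, then the converse also holds: $H$ is coisotropic with respect to $\pi_\sigma$ if and only if $\operatorname{ad}_X(\operatorname{Ad}_{\sigma^{-1}}r)\in\mathfrak h\wedge\mathfrak g$ for all $X\in\mathfrak h$. -/

import Mathlib

open scoped Manifold ContDiff

namespace PoissonLie

/-! ### Bivectors on a vector space -/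

section Algebra

variable {V : Type*} [AddCommGroup V] [Module ℝ V]

/-- The decomposable bivector `u ∧ v`. -/
noncomputable def wedge (u v : V) : ⋀[ℝ]^2 V := exteriorPower.ιMulti ℝ 2 ![u, v]

theorem wedge_add_left (u u' v : V) : wedge (u + u') v = wedge u v + wedge u' v := by
  have h := (exteriorPower.ιMulti ℝ 2 (M := V)).map_update_add ![u, v] 0 u u'
  have e (x : V) : Function.update ![u, v] 0 x = ![x, v] := by
    ext i; fin_cases i <;> simp
  rwa [e, e, e] at h

theorem wedge_smul_left (c : ℝ) (u v : V) : wedge (c • u) v = c • wedge u v := by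
  have h := (exteriorPower.ιMulti ℝ 2 (M := V)).map_update_smul ![u, v] 0 c u
  have e (x : V) : Function.update ![u, v] 0 x = ![x, v] := by
    ext i; fin_cases i <;> simp
  rwa [e, e] at h

theorem wedge_swap (u v : V) : wedge v u = - wedge u v := by
  have h := (exteriorPower.ιMulti ℝ 2 (M := V)).map_swap ![u, v] (i := 0) (j := 1) (by decide)
  rw [wedge, wedge, ← h]
  congr 1
  ext i
  fin_cases i <;> simp

theorem wedge_add_right (u v v' : V) : wedge u (v + v') = wedge u v + wedge u v' := by
  rw [wedge_swap, wedge_add_left, wedge_swap u v, wedge_swap u v']; abel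

theorem wedge_smul_right (c : ℝ) (u v : V) : wedge u (c • v) = c • wedge u v := by
  rw [wedge_swap, wedge_smul_left, wedge_swap u v]; simp

/-- For a subspace `𝔥` of `V`, the subspace `𝔥 ∧ V` of `⋀² V`, spanned by the bivectors
`u ∧ v` with `u ∈ 𝔥` and `v ∈ V`. -/
noncomputable def wedgeTop (𝔥 : Submodule ℝ V) : Submodule ℝ (⋀[ℝ]^2 V) :=
  Submodule.span ℝ {w | ∃ u ∈ 𝔥, ∃ v : V, wedge u v = w}

/-- The alternating map `(u, v) ↦ f u ∧ v + u ∧ f v`. -/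
noncomputable def derivAlternating (f : V →ₗ[ℝ] V) : V [⋀^Fin 2]→ₗ[ℝ] ⋀[ℝ]^2 V where
  toFun m := wedge (f (m 0)) (m 1) + wedge (m 0) (f (m 1))
  map_update_add' := by
    intro _ m i x y
    fin_cases i <;> simp [wedge_add_left, wedge_add_right] <;> abel
  map_update_smul' := by
    intro _ m i c x
    fin_cases i <;> simp [wedge_smul_left, wedge_smul_right]
  map_eq_zero_of_eq' := by
    intro m i j hm hij
    have h : m 0 = m 1 := by
      fin_cases i <;> fin_cases j <;> simp_all
    rw [← h, wedge_swap]; simp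

/-- The extension of an endomorphism `f` of `V` to `⋀² V` as a derivation. -/
noncomputable def derivBivector (f : V →ₗ[ℝ] V) : ⋀[ℝ]^2 V →ₗ[ℝ] ⋀[ℝ]^2 V :=
  exteriorPower.alternatingMapLinearEquiv (derivAlternating f)

theorem derivBivector_wedge (f : V →ₗ[ℝ] V) (u v : V) :
    derivBivector f (wedge u v) = wedge (f u) v + wedge u (f v) := by
  simp [derivBivector, wedge, derivAlternating]

end Algebra

/-! ### Tangent maps and bivector fields -/

section Manifold

variable {E : Type*} [NormedAddCommGroup E] [NormedSpace ℝ E]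
  {M : Type*} [TopologicalSpace M] (I : ModelWithCorners ℝ E M)
  {E' : Type*} [NormedAddCommGroup E'] [NormedSpace ℝ E']
  {M' : Type*} [TopologicalSpace M'] (I' : ModelWithCorners ℝ E' M')
  {X : Type*} [TopologicalSpace X] [ChartedSpace M X]
  {Y : Type*} [TopologicalSpace Y] [ChartedSpace M' Y]

/-- The tangent map `T_x X → T_y Y` of `f : X → Y` at `x`, where `y = f x`. (The spaces
`T_y Y` and `T_{f x} Y` are the same, and Lean identifies them by definition.) -/
noncomputable def tangentAt (f : X → Y) {x : X} {y : Y} (_h : f x = y) :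
    TangentSpace I x →ₗ[ℝ] TangentSpace I' y :=
  (mfderiv I I' f x : TangentSpace I x →L[ℝ] TangentSpace I' (f x)).toLinearMap

/-- The map `⋀² T_x X → ⋀² T_y X` induced by `f : X → X` with `f x = y`. -/
noncomputable def pushBivector (f : X → X) {x y : X} (h : f x = y) :
    ⋀[ℝ]^2 (TangentSpace I x) →ₗ[ℝ] ⋀[ℝ]^2 (TangentSpace I y) :=
  exteriorPower.map 2 (tangentAt I I f h)

/-- The differential of a real function at `x`, as an element of the cotangent space. -/
noncomputable def differential (f : X → ℝ) (x : X) : Module.Dual ℝ (TangentSpace I x) :=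
  tangentAt I 𝓘(ℝ, ℝ) f (rfl : f x = f x)

/-- The bracket `{f₁, f₂}(x) = ⟨df₁ ∧ df₂, ρ(x)⟩` defined by a bivector field `ρ`. -/
noncomputable def bracket (ρ : ∀ x : X, ⋀[ℝ]^2 (TangentSpace I x)) (f₁ f₂ : X → ℝ) : X → ℝ :=
  fun x => exteriorPower.pairingDual ℝ (TangentSpace I x) 2
    (wedge (differential I f₁ x) (differential I f₂ x)) (ρ x)

/-- `ρ` is a Poisson 2-tensor: its bracket maps pairs of smooth functions to smooth functions
(so that `ρ` is a smooth bivector field) and satisfies the Jacobi identity. -/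
structure IsPoisson (ρ : ∀ x : X, ⋀[ℝ]^2 (TangentSpace I x)) : Prop where
  smooth : ∀ f₁ f₂ : X → ℝ, ContMDiff I 𝓘(ℝ, ℝ) ∞ f₁ → ContMDiff I 𝓘(ℝ, ℝ) ∞ f₂ →
    ContMDiff I 𝓘(ℝ, ℝ) ∞ (bracket I ρ f₁ f₂)
  jacobi : ∀ f₁ f₂ f₃ : X → ℝ, ContMDiff I 𝓘(ℝ, ℝ) ∞ f₁ → ContMDiff I 𝓘(ℝ, ℝ) ∞ f₂ →
    ContMDiff I 𝓘(ℝ, ℝ) ∞ f₃ → ∀ x : X,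
    bracket I ρ f₁ (bracket I ρ f₂ f₃) x + bracket I ρ f₂ (bracket I ρ f₃ f₁) x +
      bracket I ρ f₃ (bracket I ρ f₁ f₂) x = 0

end Manifold

/-! ### Lie groups -/

section Group

variable {E : Type*} [NormedAddCommGroup E] [NormedSpace ℝ E]
  {M : Type*} [TopologicalSpace M] (I : ModelWithCorners ℝ E M)
  {G : Type*} [TopologicalSpace G] [ChartedSpace M G] [Group G]

/-- The action `⋀² T_x G → ⋀² T_y G` of left translation by `g`, where `y = g x`. -/
noncomputable def leftPush (g : G) {x y : G} (h : g * x = y) :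
    ⋀[ℝ]^2 (TangentSpace I x) →ₗ[ℝ] ⋀[ℝ]^2 (TangentSpace I y) :=
  pushBivector I (fun z => g * z) h

/-- The action `⋀² T_x G → ⋀² T_y G` of right translation by `g`, where `y = x g`. -/
noncomputable def rightPush (g : G) {x y : G} (h : x * g = y) :
    ⋀[ℝ]^2 (TangentSpace I x) →ₗ[ℝ] ⋀[ℝ]^2 (TangentSpace I y) :=
  pushBivector I (fun z => z * g) h

/-- A Poisson-Lie structure on `G`: a Poisson 2-tensor `π` which is multiplicative, that is,
`π(gh) = L_g π(h) + R_h π(g)`. -/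
structure IsPoissonLie (π : ∀ g : G, ⋀[ℝ]^2 (TangentSpace I g)) : Prop where
  poisson : IsPoisson I π
  multiplicative : ∀ g h : G,
    π (g * h) = leftPush I g (rfl : g * h = g * h) (π h) + rightPush I h rfl (π g)

/-- The bivector field `g ↦ L_g r - R_g r`. -/
noncomputable def rMatrixField (r : ⋀[ℝ]^2 (GroupLieAlgebra I G)) (g : G) :
    ⋀[ℝ]^2 (TangentSpace I g) :=
  leftPush I g (mul_one g) r - rightPush I g (one_mul g) r

/-- The right translate `π_σ(g) = R_σ(π(g σ⁻¹))` of a bivector field `π`. -/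
noncomputable def rightTranslate (π : ∀ g : G, ⋀[ℝ]^2 (TangentSpace I g)) (σ : G) (g : G) :
    ⋀[ℝ]^2 (TangentSpace I g) :=
  rightPush I σ (inv_mul_cancel_right g σ) (π (g * σ⁻¹))

/-- The adjoint action of `g` on `⋀² 𝔤`, induced by the tangent map at `1` of `z ↦ g z g⁻¹`. -/
noncomputable def AdBivector (g : G) :
    ⋀[ℝ]^2 (GroupLieAlgebra I G) →ₗ[ℝ] ⋀[ℝ]^2 (GroupLieAlgebra I G) :=
  pushBivector I (fun z : G => g * z * g⁻¹) (x := 1) (y := 1) (by simp)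

variable [LieGroup I ∞ G]

/-- The derivative of the multiplication at `(1, 1)` is addition. -/
theorem mfderiv_mul_one_one (a b : G) (ha : a = 1) (hb : b = 1) (v w : E) :
    (show E × E →L[ℝ] E from mfderiv (I.prod I) I (fun p : G × G => p.1 * p.2) (a, b)) (v, w)
      = v + w := by
  subst ha hb
  have m : MDifferentiableAt (I.prod I) I (fun p : G × G => p.1 * p.2) ((1, 1) : G × G) :=
    (contMDiff_mul I ∞).mdifferentiableAt (by simp)
  refine (mfderiv_prod_eq_add_apply (p := ((1, 1) : G × G)) m (v := (v, w))).trans ?_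
  have e1 : HasMFDerivAt I I (fun z : G => z * 1) 1 (ContinuousLinearMap.id ℝ E) := by
    have : (fun z : G => z * 1) = id := by ext; simp
    rw [this]; exact hasMFDerivAt_id 1
  have e2 : HasMFDerivAt I I (fun z : G => 1 * z) 1 (ContinuousLinearMap.id ℝ E) := by
    have : (fun z : G => 1 * z) = id := by ext; simp
    rw [this]; exact hasMFDerivAt_id 1
  exact congrArg₂ (fun A B : E →L[ℝ] E => A v + B w) e1.mfderiv e2.mfderiv

/-- The Lie algebra `𝔥` of a closed subgroup `H` of `G`, as a subspace of `𝔤 = T_1 G`: the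
velocities at time `0` of the smooth curves in `G` which lie in `H` and pass through `1` at
time `0`. -/
noncomputable def subgroupLieAlgebra (H : Subgroup G) : Submodule ℝ (GroupLieAlgebra I G) where
  carrier := {X | ∃ (γ : ℝ → G) (h0 : γ 0 = 1), ContMDiff 𝓘(ℝ, ℝ) I ∞ γ ∧ (∀ t, γ t ∈ H) ∧
    tangentAt 𝓘(ℝ, ℝ) I γ h0 (1 : ℝ) = X}
  zero_mem' := by
    refine ⟨fun _ => 1, rfl, contMDiff_const, fun _ => H.one_mem, ?_⟩
    rw [tangentAt, mfderiv_const]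
    rfl
  add_mem' := by
    rintro _ _ ⟨γ, h0, hγ, hH, rfl⟩ ⟨δ, k0, hδ, kH, rfl⟩
    refine ⟨fun t => γ t * δ t, by simp [h0, k0], hγ.mul hδ, fun t => H.mul_mem (hH t) (kH t), ?_⟩
    have e1 := hγ.mdifferentiable (by simp) 0
    have e2 := hδ.mdifferentiable (by simp) 0
    have m : MDifferentiableAt (I.prod I) I (fun p : G × G => p.1 * p.2) (γ 0, δ 0) :=
      (contMDiff_mul I ∞).mdifferentiableAt (by simp)
    have h1 := (m.hasMFDerivAt.comp (0 : ℝ) (e1.hasMFDerivAt.prodMk e2.hasMFDerivAt)).mfderiv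
    have h2 := mfderiv_mul_one_one I (γ 0) (δ 0) h0 k0 (mfderiv 𝓘(ℝ, ℝ) I γ 0 (1 : ℝ))
      (mfderiv 𝓘(ℝ, ℝ) I δ 0 (1 : ℝ))
    refine Eq.trans ?_ h2
    exact congrArg (fun L : ℝ →L[ℝ] E => L 1) h1
  smul_mem' := by
    rintro c _ ⟨γ, h0, hγ, hH, rfl⟩
    have hc : ContMDiff 𝓘(ℝ, ℝ) 𝓘(ℝ, ℝ) ∞ (fun t : ℝ => c * t) :=
      (contDiff_const.mul contDiff_id).contMDiff
    refine ⟨fun t => γ (c * t), by simp [h0], hγ.comp hc, fun t => hH _, ?_⟩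
    have hd : HasMFDerivAt 𝓘(ℝ, ℝ) 𝓘(ℝ, ℝ) (fun t : ℝ => c * t) 0
        (c • ContinuousLinearMap.id ℝ ℝ) :=
      ((hasFDerivAt_id (𝕜 := ℝ) (0 : ℝ)).const_mul c).hasMFDerivAt
    have e1 : HasMFDerivAt 𝓘(ℝ, ℝ) I γ (c * 0) (mfderiv 𝓘(ℝ, ℝ) I γ 0) := by
      have h := (hγ.mdifferentiable (by simp) 0).hasMFDerivAt
      rw [mul_zero]; exact h
    have h1 := (e1.comp (0 : ℝ) hd).mfderiv
    refine (congrArg (fun L : ℝ →L[ℝ] E => L 1) h1).trans ?_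
    change (mfderiv 𝓘(ℝ, ℝ) I γ 0 : ℝ →L[ℝ] E) (c • (1 : ℝ)) = _
    exact ContinuousLinearMap.map_smul (mfderiv 𝓘(ℝ, ℝ) I γ 0 : ℝ →L[ℝ] E) c 1

/-- The closed subgroup `H` is coisotropic with respect to the bivector field `ρ`:
`ρ(gh) - R_h(ρ(g)) ∈ L_{gh}(𝔥 ∧ 𝔤)` for all `g ∈ G` and `h ∈ H`. -/
def IsCoisotropic (H : Subgroup G) (ρ : ∀ g : G, ⋀[ℝ]^2 (TangentSpace I g)) : Prop :=
  ∀ g h : G, h ∈ H → ρ (g * h) - rightPush I h (rfl : g * h = g * h) (ρ g) ∈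
    (wedgeTop (subgroupLieAlgebra I H)).map (leftPush I (g * h) (mul_one (g * h)))

variable [FiniteDimensional ℝ E]

/-- The linear map `ad_X = [X, ·]` on the Lie algebra `𝔤` of `G`. -/
noncomputable def adMap (X : GroupLieAlgebra I G) :
    GroupLieAlgebra I G →ₗ[ℝ] GroupLieAlgebra I G :=
  haveI : CompleteSpace E := FiniteDimensional.complete ℝ E
  haveI : LieGroup I (minSmoothness ℝ 3) G := LieGroup.of_le (n := ∞) (by
    rw [minSmoothness_of_isRCLikeNormedField]; exact ENat.LEInfty.out)
  { toFun := fun Y => ⁅X, Y⁆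
    map_add' := fun Y Z => lie_add X Y Z
    map_smul' := fun c Y => lie_smul c X Y }

/-- The action of `X ∈ 𝔤` on `⋀² 𝔤`: `ad_X (u ∧ v) = [X, u] ∧ v + u ∧ [X, v]`. -/
noncomputable def adBivector (X : GroupLieAlgebra I G) :
    ⋀[ℝ]^2 (GroupLieAlgebra I G) →ₗ[ℝ] ⋀[ℝ]^2 (GroupLieAlgebra I G) :=
  derivBivector (adMap I X)

end Group

end PoissonLie

/-! Put `s = Ad_{σ⁻¹} r`. Then `π_σ(g) = L_g s - R_g r`, and the second term is right invariant, so
`π_σ(gh) - R_h π_σ(g) = L_{gh}(s - Ad_{h⁻¹} s)`. Coisotropy of `H` for `π_σ` therefore means that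
`Ad_h s - s ∈ 𝔥 ∧ 𝔤` for all `h ∈ H` (`isCoisotropic_rightTranslate_iff`). Differentiating along
curves in `H` gives `ad_X s ∈ 𝔥 ∧ 𝔤`, because the derivative of `Ad` at the unit is `ad`
(`hasDerivAt_AdMap`).

Conversely, `Ad_h` preserves `𝔥 ∧ 𝔤` for `h ∈ H`, so the `h ∈ H` with `Ad_h s - s ∈ 𝔥 ∧ 𝔤` form a
subgroup `K` (`stabilizerMod`). If `ad_X s ∈ 𝔥 ∧ 𝔤` for all `X ∈ 𝔥`, then `Ad_{γ(t)} s` is constant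
modulo `𝔥 ∧ 𝔤` along every smooth curve `γ` in `H` with `γ(0) = 1`, so `K` contains all these
curves.

As `𝔥` is defined by curves, what remains is Cartan's closed subgroup theorem: such curves fill a
neighbourhood of `1` in `H` (`eventually_mem_of_curve_mem`). Its core is
`mem_subgroupLieAlgebra_of_tendsto`: limit directions of sequences in `H` tending to `1` lie in `𝔥`.
Then `K` is open in `H`, and equals `H` when `H` is connected. The analysis is done in a chart at
the unit, where `G` becomes a local group on `E`. -/

namespace PoissonLie

/-! ### Functoriality of the push-forward of bivectors -/

section Functoriality

variable {E : Type*} [NormedAddCommGroup E] [NormedSpace ℝ E]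
  {M : Type*} [TopologicalSpace M] {I : ModelWithCorners ℝ E M}
  {X : Type*} [TopologicalSpace X] [ChartedSpace M X]

theorem pushBivector_pushBivector {f g k : X → X} (hf : MDifferentiable I I f)
    (hg : MDifferentiable I I g) (hk : ∀ z, g (f z) = k z) {x y z : X} (h₁ : f x = y)
    (h₂ : g y = z) (h₃ : k x = z) (w : ⋀[ℝ]^2 (TangentSpace I x)) :
    pushBivector I g h₂ (pushBivector I f h₁ w) = pushBivector I k h₃ w := by
  obtain rfl : k = g ∘ f := funext fun z => (hk z).symm
  subst h₁ h₂
  have e : tangentAt I I (g ∘ f) h₃ =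
      (tangentAt I I g (rfl : g (f x) = g (f x))).comp
        (tangentAt I I f (rfl : f x = f x)) := by
    have := mfderiv_comp x (hg (f x)) (hf x)
    unfold tangentAt
    exact congrArg ContinuousLinearMap.toLinearMap this
  rw [pushBivector, pushBivector, pushBivector, e, exteriorPower.map_comp]
  rfl

theorem pushBivector_of_forall_eq {f : X → X} (hf : ∀ z, f z = z) {x : X} (h : f x = x)
    (w : ⋀[ℝ]^2 (TangentSpace I x)) : pushBivector I f h w = w := by
  obtain rfl : f = id := funext hf
  have e : tangentAt I I (id : X → X) h = LinearMap.id := by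
    unfold tangentAt
    exact congrArg ContinuousLinearMap.toLinearMap (mfderiv_id (I := I) (x := x))
  rw [pushBivector, e, exteriorPower.map_id]
  rfl

end Functoriality

/-! ### Coisotropy as invariance of `Ad_{σ⁻¹} r` modulo `𝔥 ∧ 𝔤` -/

section Reduction

variable {E : Type*} [NormedAddCommGroup E] [NormedSpace ℝ E]
  {M : Type*} [TopologicalSpace M] {I : ModelWithCorners ℝ E M}
  {G : Type*} [TopologicalSpace G] [ChartedSpace M G] [Group G] [LieGroup I ∞ G]

theorem mdifferentiable_mul_mul (a b : G) : MDifferentiable I I (fun z : G => a * z * b) :=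
  ((contMDiff_mul_right (I := I) (n := ∞) (a := b)).comp
    (contMDiff_mul_left (I := I) (n := ∞) (a := a))).mdifferentiable (by simp)

theorem mdifferentiable_mul_left' (a : G) : MDifferentiable I I (fun z : G => a * z) :=
  (contMDiff_mul_left (I := I) (n := ∞) (a := a)).mdifferentiable (by simp)

theorem mdifferentiable_mul_right' (a : G) : MDifferentiable I I (fun z : G => z * a) :=
  (contMDiff_mul_right (I := I) (n := ∞) (a := a)).mdifferentiable (by simp)

theorem leftPush_injective (g : G) {x y : G} (h : g * x = y) :
    Function.Injective (leftPush I g h) := by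
  have h' : g⁻¹ * y = x := by rw [← h]; group
  have key (w) : leftPush I g⁻¹ h' (leftPush I g h w) = w := by
    unfold leftPush
    rw [pushBivector_pushBivector (mdifferentiable_mul_left' g) (mdifferentiable_mul_left' g⁻¹)
      (k := fun z => z) (by intro z; group) h h' rfl]
    exact pushBivector_of_forall_eq (fun _ => rfl) rfl w
  exact Function.LeftInverse.injective key

theorem AdBivector_mul (g h : G) (w : ⋀[ℝ]^2 (GroupLieAlgebra I G)) :
    AdBivector I (g * h) w = AdBivector I g (AdBivector I h w) :=
  (pushBivector_pushBivector (mdifferentiable_mul_mul h h⁻¹) (mdifferentiable_mul_mul g g⁻¹)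
    (by intro z; group) _ _ _ w).symm

omit [LieGroup I ∞ G] in
theorem AdBivector_one (w : ⋀[ℝ]^2 (GroupLieAlgebra I G)) : AdBivector I (1 : G) w = w :=
  pushBivector_of_forall_eq (by simp) _ w

/-- The failure of the translate `π_σ` of `L_g r - R_g r` to be right invariant under `h`. -/
theorem rightTranslate_rMatrixField_sub (r : ⋀[ℝ]^2 (GroupLieAlgebra I G)) (σ g h : G) :
    rightTranslate I (rMatrixField I r) σ (g * h) -
        rightPush I h (rfl : g * h = g * h) (rightTranslate I (rMatrixField I r) σ g) =
      leftPush I (g * h) (mul_one (g * h))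
        (AdBivector I σ⁻¹ r - AdBivector I h⁻¹ (AdBivector I σ⁻¹ r)) := by
  simp only [rightTranslate, rMatrixField, map_sub]
  unfold leftPush rightPush AdBivector
  have L := mdifferentiable_mul_left' (I := I) (G := G)
  have R := mdifferentiable_mul_right' (I := I) (G := G)
  have T := mdifferentiable_mul_mul (I := I) (G := G)
  -- Every term is the push-forward of `r` along some `z ↦ a z b`. Once all are in this form, the
  -- two copies of `z ↦ z (g h)` cancel and the others match.
  rw [pushBivector_pushBivector (L (g * h * σ⁻¹)) (R σ)
      (k := fun z => g * h * σ⁻¹ * z * σ) (fun _ => rfl) _ _ (by group) r,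
    pushBivector_pushBivector (R (g * h * σ⁻¹)) (R σ)
      (k := fun z => z * (g * h)) (fun _ => by group) _ _ (by group) r,
    pushBivector_pushBivector (L (g * σ⁻¹)) (R σ)
      (k := fun z => g * σ⁻¹ * z * σ) (fun _ => rfl) _ _ (by group) r,
    pushBivector_pushBivector (R (g * σ⁻¹)) (R σ)
      (k := fun z => z * g) (fun _ => by group) _ _ (by group) r,
    pushBivector_pushBivector (T (g * σ⁻¹) σ) (R h)
      (k := fun z => g * σ⁻¹ * z * (σ * h)) (fun _ => by group) _ _ (by group) r,
    pushBivector_pushBivector (R g) (R h)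
      (k := fun z => z * (g * h)) (fun _ => by group) _ _ (by group) r,
    pushBivector_pushBivector (T σ⁻¹ σ⁻¹⁻¹) (L (g * h))
      (k := fun z => g * h * σ⁻¹ * z * σ) (fun _ => by group) _ _ (by group) r,
    pushBivector_pushBivector (T σ⁻¹ σ⁻¹⁻¹) (T h⁻¹ h⁻¹⁻¹)
      (k := fun z => h⁻¹ * σ⁻¹ * z * (σ * h)) (fun _ => by group) _ _ (by group) r,
    pushBivector_pushBivector (T (h⁻¹ * σ⁻¹) (σ * h)) (L (g * h))
      (k := fun z => g * σ⁻¹ * z * (σ * h)) (fun _ => by group) _ _ (by group) r]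
  abel

/-- `H` is coisotropic for the translate `π_σ` iff `Ad_{σ⁻¹} r` is `H`-invariant
modulo `𝔥 ∧ 𝔤`. -/
theorem isCoisotropic_rightTranslate_iff (r : ⋀[ℝ]^2 (GroupLieAlgebra I G)) (H : Subgroup G)
    (σ : G) :
    IsCoisotropic I H (rightTranslate I (rMatrixField I r) σ) ↔
      ∀ h ∈ H, AdBivector I h (AdBivector I σ⁻¹ r) - AdBivector I σ⁻¹ r ∈
        wedgeTop (subgroupLieAlgebra I H) := by
  have key (g h : G) : rightTranslate I (rMatrixField I r) σ (g * h) -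
        rightPush I h (rfl : g * h = g * h) (rightTranslate I (rMatrixField I r) σ g) ∈
      (wedgeTop (subgroupLieAlgebra I H)).map (leftPush I (g * h) (mul_one (g * h))) ↔
      AdBivector I h⁻¹ (AdBivector I σ⁻¹ r) - AdBivector I σ⁻¹ r ∈
        wedgeTop (subgroupLieAlgebra I H) := by
    rw [rightTranslate_rMatrixField_sub, ← Submodule.neg_mem_iff (x := AdBivector I h⁻¹ _ - _),
      neg_sub]
    constructor
    · rintro ⟨w, hw, e⟩
      rw [← leftPush_injective _ _ e]
      exact hw
    · exact fun hw => ⟨_, hw, rfl⟩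
  constructor
  -- The condition in `key` does not involve `g`, so the instance `g = 1` gives it for all `g`.
  · intro hc h hh
    have := (key 1 h⁻¹).1 (hc 1 h⁻¹ (H.inv_mem hh))
    rwa [inv_inv] at this
  · intro hc g h hh
    exact (key g h).2 (hc h⁻¹ (H.inv_mem hh))

end Reduction

/-! ### One-parameter subgroups of a local group -/

section LocalGroup

open Filter Topology Set

variable {E : Type*} [NormedAddCommGroup E] [NormedSpace ℝ E]

/-- Left invariance of the vector fields generating right translations in a local group: if `P` is a locally associative
product, then `v x = ∂₂P(x, 0) Y` satisfies `v (P (a, b)) = ∂₂P(a, b) (v b)` near `0`. -/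
theorem eventually_fderiv_mul_eq {P : E × E → E} (h0 : P (0, 0) = 0)
    (hP : ∀ᶠ p in 𝓝 (0 : E × E), ContDiffAt ℝ ∞ P p)
    (hl : ∀ᶠ x in 𝓝 (0 : E), P (x, 0) = x)
    (ha : ∀ᶠ p in 𝓝 (0 : (E × E) × E), P (P p.1, p.2) = P (p.1.1, P (p.1.2, p.2))) (Y : E) :
    ∀ᶠ p in 𝓝 (0 : E × E),
      fderiv ℝ P (P p, 0) (0, Y) = fderiv ℝ P p (0, fderiv ℝ P (p.2, 0) (0, Y)) := by
  have hPc : Tendsto P (𝓝 0) (𝓝 0) := by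
    have := hP.self_of_nhds.continuousAt
    rwa [ContinuousAt, show P (0 : E × E) = 0 from h0] at this
  have t0 {f : E × E → E} (hf : Tendsto f (𝓝 0) (𝓝 0)) :
      Tendsto (fun p : E × E => (f p, (0 : E))) (𝓝 0) (𝓝 (0 : E × E)) := by
    have := hf.prodMk_nhds (tendsto_const_nhds (x := (0 : E)))
    exact this
  have t2 : Tendsto (fun p : E × E => p.2) (𝓝 0) (𝓝 0) := by
    have := (continuous_snd (X := E) (Y := E)).tendsto 0
    exact this
  have ha' : ∀ᶠ p in 𝓝 (0 : E × E), ∀ᶠ y in 𝓝 (0 : E), P (P p, y) = P (p.1, P (p.2, y)) := by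
    rw [show (0 : (E × E) × E) = (0, 0) from rfl] at ha
    exact ha.curry_nhds
  filter_upwards [ha', hP, (t0 hPc).eventually hP, (t0 t2).eventually hP, t2.eventually hl]
    with p h1 h2 h3 h4 h5
  have c {q : E × E} (hq : ContDiffAt ℝ ∞ P q) : HasFDerivAt P (fderiv ℝ P q) q :=
    (hq.differentiableAt (by simp)).hasFDerivAt
  have i (a b : E) : HasFDerivAt (fun y : E => (a, y)) (ContinuousLinearMap.inr ℝ E E) b :=
    hasFDerivAt_prodMk_right a b
  -- Both sides of `P (P (a, b), y) = P (a, P (b, y))` are differentiated in `y` at `0`.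
  have d1 := (c h3).comp (0 : E) (i (P p) 0)
  have d2 := (c h4).comp (0 : E) (i p.2 0)
  have h2' := c h2
  rw [show p = (p.1, P (p.2, 0)) by rw [h5]] at h2'
  have d3 := h2'.comp (0 : E) ((i p.1 (P (p.2, 0))).comp (0 : E) d2)
  have e := d1.unique (d3.congr_of_eventuallyEq h1)
  have := DFunLike.congr_fun e Y
  simp only [h5] at this
  simpa using this

/-- A local group has local one-parameter subgroups with any given initial velocity. -/
theorem exists_local_oneParameterSubgroup [CompleteSpace E] {P : E × E → E}
    (hP : ∀ᶠ p in 𝓝 (0 : E × E), ContDiffAt ℝ ∞ P p)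
    (hl : ∀ᶠ x in 𝓝 (0 : E), P (x, 0) = x) (hr : ∀ᶠ x in 𝓝 (0 : E), P (0, x) = x)
    (ha : ∀ᶠ p in 𝓝 (0 : (E × E) × E), P (P p.1, p.2) = P (p.1.1, P (p.1.2, p.2))) (Y : E) :
    ∃ (x : ℝ → E) (δ : ℝ), 0 < δ ∧ x 0 = 0 ∧ HasDerivAt x Y 0 ∧ ContDiffOn ℝ ∞ x (Ioo (-δ) δ) ∧
      ∀ s ∈ Ioo (-δ) δ, ∀ t ∈ Ioo (-δ) δ, x (s + t) = P (x s, x t) := by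
  have h0 : P (0, 0) = 0 := hl.self_of_nhds
  -- The one-parameter subgroup is the integral curve through `0` of the left invariant field with
  -- value `Y` at `0`.
  set v : E → E := fun x => fderiv ℝ P (x, 0) (0, Y) with hv
  have ti : Tendsto (fun x : E => (x, (0 : E))) (𝓝 0) (𝓝 (0 : E × E)) :=
    (Continuous.prodMk_left (0 : E)).tendsto' _ _ rfl
  have hvs : ∀ᶠ x in 𝓝 (0 : E), ContDiffAt ℝ ∞ v x := by
    filter_upwards [ti.eventually hP] with x hx
    have : ContDiffAt ℝ ∞ (fderiv ℝ P) (x, 0) := hx.fderiv_right (by simp)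
    exact (this.comp x (by fun_prop : ContDiffAt ℝ ∞ (fun x : E => (x, (0 : E))) x)).clm_apply
      contDiffAt_const
  have hv0 : v 0 = Y := by
    have d1 : HasFDerivAt (fun y : E => P (0, y)) _ 0 :=
      (hP.self_of_nhds.differentiableAt (by simp)).hasFDerivAt.comp (0 : E)
        (hasFDerivAt_prodMk_right (𝕜 := ℝ) (0 : E) (0 : E))
    have d2 : HasFDerivAt (fun y : E => P (0, y)) (ContinuousLinearMap.id ℝ E) 0 :=
      (hasFDerivAt_id (0 : E)).congr_of_eventuallyEq hr
    have := DFunLike.congr_fun (d1.unique d2) Y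
    simp only [ContinuousLinearMap.comp_apply, ContinuousLinearMap.inr_apply,
      ContinuousLinearMap.id_apply] at this
    exact this
  have hv1 : ContDiffAt ℝ 1 v 0 := hvs.self_of_nhds.of_le (by simp)
  obtain ⟨x, hx0, ε, hε, hx⟩ :=
    hv1.exists_forall_mem_closedBall_exists_eq_forall_mem_Ioo_hasDerivAt₀ 0
  simp only [zero_sub, zero_add] at hx
  obtain ⟨K, U, hU, hK⟩ := hv1.exists_lipschitzOnWith
  have hx' : ∀ᶠ t in 𝓝 (0 : ℝ), HasDerivAt x (v (x t)) t := by
    filter_upwards [Ioo_mem_nhds (neg_lt_zero.2 hε) hε] with t ht using hx t ht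
  have hxc : Tendsto x (𝓝 0) (𝓝 0) := by
    have := hx'.self_of_nhds.continuousAt
    rwa [ContinuousAt, hx0] at this
  have f1 : Tendsto (fun p : ℝ × ℝ => p.1) (𝓝 0) (𝓝 0) := continuous_fst.tendsto' _ _ rfl
  have f2 : Tendsto (fun p : ℝ × ℝ => p.2) (𝓝 0) (𝓝 0) := continuous_snd.tendsto' _ _ rfl
  have f3 : Tendsto (fun p : ℝ × ℝ => p.1 + p.2) (𝓝 0) (𝓝 0) :=
    (continuous_fst.add continuous_snd).tendsto' _ _ (by simp)
  have f4 : Tendsto (fun p : ℝ × ℝ => (x p.1, x p.2)) (𝓝 0) (𝓝 (0 : E × E)) :=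
    (hxc.comp f1).prodMk_nhds (hxc.comp f2)
  have hPc : Tendsto P (𝓝 0) (𝓝 0) := by
    have := hP.self_of_nhds.continuousAt
    rwa [ContinuousAt, show P (0 : E × E) = 0 from h0] at this
  have all := (f3.eventually hx').and <| ((hxc.comp f3).eventually hU).and <|
    (f2.eventually hx').and <| ((hPc.comp f4).eventually hU).and <| (f4.eventually hP).and <|
    (f4.eventually (eventually_fderiv_mul_eq h0 hP hl ha Y)).and <|
    (f2.eventually (hxc.eventually hvs)).and <| f1.eventually (hxc.eventually hl)
  -- A neighbourhood of `(0, 0)` contains a square, so a single `δ` serves for both `s` and `t`.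
  rw [show (0 : ℝ × ℝ) = (0, 0) from rfl, nhds_prod_eq, eventually_prod_self_iff'] at all
  obtain ⟨N, hN, hall⟩ := all
  obtain ⟨δ, hδ, hNδ⟩ := Metric.mem_nhds_iff.1 hN
  rw [Real.ball_eq_Ioo, zero_sub, zero_add] at hNδ
  have h0δ : (0 : ℝ) ∈ Ioo (-δ) δ := ⟨by linarith, hδ⟩
  refine ⟨x, δ, hδ, hx0, ?_, ?_, ?_⟩
  · have := hx'.self_of_nhds
    rwa [hx0, hv0] at this
  · intro t ht
    obtain ⟨b, hb1, hb2⟩ : ∃ b, |t| < b ∧ b < δ := exists_between (abs_lt.2 ht)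
    have hsub : Icc (-b) b ⊆ Ioo (-δ) δ := fun u hu => ⟨by linarith [hu.1], by linarith [hu.2]⟩
    have := ODE.contDiffOn_enat_Icc_of_hasDerivWithinAt (n := ⊤) (f := fun _ : ℝ => v) (α := x)
      (tmin := -b) (tmax := b) (u := {y | ContDiffAt ℝ ∞ v y}) ?_ ?_ ?_
    · refine (this.contDiffAt (Icc_mem_nhds ?_ ?_)).contDiffWithinAt
      · linarith [neg_abs_le t]
      · linarith [le_abs_self t]
    · intro p hp
      have hp2 : ContDiffAt ℝ ∞ v p.2 := hp.2
      exact (hp2.comp p contDiffAt_snd).contDiffWithinAt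
    · intro u hu
      exact (hall 0 (hNδ h0δ) u (hNδ (hsub hu))).2.2.1.hasDerivWithinAt
    · intro u hu
      exact (hall 0 (hNδ h0δ) u (hNδ (hsub hu))).2.2.2.2.2.2.1
  -- By left invariance of `v`, both `t ↦ x (s + t)` and `t ↦ P (x s, x t)` are integral curves of
  -- `v`. They agree at `t = 0`, hence everywhere on the interval.
  · intro s hs
    have := ODE_solution_unique_of_mem_Ioo (v := fun _ => v) (s := fun _ => U) (K := K)
      (f := fun t => x (s + t)) (g := fun t => P (x s, x t)) (a := -δ) (b := δ) (t₀ := 0)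
      (fun _ _ => hK) h0δ ?_ ?_ ?_
    · exact this
    · intro t ht
      obtain ⟨k1, k2, -⟩ := hall s (hNδ hs) t (hNδ ht)
      exact ⟨k1.comp_const_add s t, k2⟩
    · intro t ht
      obtain ⟨-, -, k3, k4, k5, k6, -⟩ := hall s (hNδ hs) t (hNδ ht)
      refine ⟨?_, k4⟩
      have := (k5.differentiableAt (by simp)).hasFDerivAt.comp_hasDerivAt t
        ((hasDerivAt_const t (x s)).prodMk k3)
      simp only at k6
      change HasDerivAt _ (fderiv ℝ P (P (x s, x t), 0) (0, Y)) t
      rw [k6]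
      exact this
    · obtain ⟨-, -, -, -, -, -, -, k⟩ := hall s (hNδ hs) 0 (hNδ h0δ)
      simp only [add_zero, hx0]
      exact k.symm

end LocalGroup

/-! ### The derivative of conjugation in a local group -/

section LocalGroup

open Filter Topology Set

variable {E : Type*} [NormedAddCommGroup E] [NormedSpace ℝ E]

/-- The two unit laws say that both partial derivatives at the unit are the identity. -/
theorem fderiv_mul_zero_apply {P : E × E → E} (hP : ContDiffAt ℝ ∞ P 0)
    (hl : ∀ᶠ x in 𝓝 (0 : E), P (x, 0) = x) (hr : ∀ᶠ x in 𝓝 (0 : E), P (0, x) = x) (u v : E) :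
    fderiv ℝ P 0 (u, v) = u + v := by
  have hd : HasFDerivAt P (fderiv ℝ P 0) (0, 0) :=
    (hP.differentiableAt (by simp)).hasFDerivAt
  have d1 := hd.comp (f := fun x : E => (x, (0 : E))) (0 : E)
    (hasFDerivAt_prodMk_left (𝕜 := ℝ) (0 : E) (0 : E))
  have d2 := hd.comp (0 : E) (hasFDerivAt_prodMk_right (𝕜 := ℝ) (0 : E) (0 : E))
  have e1 := DFunLike.congr_fun (d1.unique ((hasFDerivAt_id (0 : E)).congr_of_eventuallyEq hl)) u
  have e2 := DFunLike.congr_fun (d2.unique ((hasFDerivAt_id (0 : E)).congr_of_eventuallyEq hr)) v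
  have e : ((u, v) : E × E) = (u, 0) + (0, v) := by simp
  rw [e, map_add]
  exact congrArg₂ (· + ·) e1 e2

/-- In a local group with product `P` and conjugation `Q`, the derivative at the unit of the
adjoint action is the Lie bracket of left invariant vector fields. -/
theorem exists_hasFDerivAt_conj {P Q : E × E → E}
    (hP : ContDiffAt ℝ ∞ P 0) (hQ : ∀ᶠ p in 𝓝 (0 : E × E), ContDiffAt ℝ ∞ Q p)
    (hl : ∀ᶠ x in 𝓝 (0 : E), P (x, 0) = x) (hr : ∀ᶠ x in 𝓝 (0 : E), P (0, x) = x)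
    (hQ0 : ∀ᶠ x in 𝓝 (0 : E), Q (x, 0) = 0) (hQ1 : ∀ᶠ x in 𝓝 (0 : E), Q (0, x) = x)
    (hPQ : ∀ᶠ p in 𝓝 (0 : E × E), P (Q p, p.1) = P p) (v : E) :
    ∃ D : E →L[ℝ] E, HasFDerivAt (fun x => fderiv ℝ (fun y => Q (x, y)) 0 v) D 0 ∧
      ∀ X, D X = VectorField.lieBracket ℝ (fun x => fderiv ℝ P (x, 0) (0, X))
        (fun x => fderiv ℝ P (x, 0) (0, v)) 0 := by
  have hP1 : ∀ᶠ p in 𝓝 (0 : E × E), DifferentiableAt ℝ P p :=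
    ((hP.of_le (show (1 : WithTop ℕ∞) ≤ ∞ by simp)).eventually (by simp)).mono
      fun p hp => hp.differentiableAt (by simp)
  have ti : Tendsto (fun x : E => (x, (0 : E))) (𝓝 0) (𝓝 (0 : E × E)) :=
    (Continuous.prodMk_left (0 : E)).tendsto' _ _ rfl
  have tj : Tendsto (fun x : E => ((0 : E), x)) (𝓝 0) (𝓝 (0 : E × E)) :=
    (Continuous.prodMk_right (0 : E)).tendsto' _ _ rfl
  set a : E → E := fun x => fderiv ℝ Q (x, 0) (0, v) with ha
  have hQd {x : E} (hx : ContDiffAt ℝ ∞ Q (x, 0)) :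
      HasFDerivAt (fun y => Q (x, y))
        ((fderiv ℝ Q (x, 0)).comp (ContinuousLinearMap.inr ℝ E E)) 0 :=
    ((hx.differentiableAt (by simp)).hasFDerivAt).comp (0 : E)
      (hasFDerivAt_prodMk_right (𝕜 := ℝ) x (0 : E))
  have hae : (fun x => fderiv ℝ (fun y => Q (x, y)) 0 v) =ᶠ[𝓝 0] a := by
    filter_upwards [ti.eventually hQ] with x hx
    rw [(hQd hx).fderiv]
    simp [ha]
  have ha0 : a 0 = v := by
    have := DFunLike.congr_fun ((hQd hQ.self_of_nhds).unique
      ((hasFDerivAt_id (0 : E)).congr_of_eventuallyEq hQ1)) v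
    simpa using this
  have hd2P : HasFDerivAt (fderiv ℝ P) (fderiv ℝ (fderiv ℝ P) 0) (0 : E × E) :=
    ((hP.fderiv_right (m := 1) (le_of_eq_of_le one_add_one_eq_two ENat.LEInfty.out)).differentiableAt
      (by simp)).hasFDerivAt
  have hd2Q : DifferentiableAt ℝ (fderiv ℝ Q) (0, 0) :=
    (hQ.self_of_nhds.fderiv_right (m := 1) (le_of_eq_of_le one_add_one_eq_two ENat.LEInfty.out)).differentiableAt
      (by simp)
  set B := fderiv ℝ (fderiv ℝ P) 0 with hB
  have had : DifferentiableAt ℝ a 0 :=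
    (DifferentiableAt.comp (f := fun x : E => (x, (0 : E))) (0 : E) hd2Q
      (hasFDerivAt_prodMk_left (𝕜 := ℝ) (0 : E) (0 : E)).differentiableAt).clm_apply
      (differentiableAt_const _)
  have hV (X : E) : HasFDerivAt (fun x => fderiv ℝ P (x, 0) (0, X))
      ((B.comp (ContinuousLinearMap.inl ℝ E E)).flip (0, X)) 0 := by
    have h1 : HasFDerivAt (fun x => fderiv ℝ P (x, 0)) (B.comp (ContinuousLinearMap.inl ℝ E E)) 0 :=
      HasFDerivAt.comp (0 : E) hd2P (hasFDerivAt_prodMk_left (𝕜 := ℝ) (0 : E) (0 : E))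
    simpa using h1.clm_apply (hasFDerivAt_const ((0 : E), X) (0 : E))
  have hV0 (X : E) : fderiv ℝ P ((0 : E), (0 : E)) (0, X) = X := by
    have := fderiv_mul_zero_apply hP hl hr 0 X
    rwa [zero_add] at this
  have hPQ' : ∀ᶠ x in 𝓝 (0 : E), ∀ᶠ y in 𝓝 (0 : E), P (Q (x, y), x) = P (x, y) := by
    rw [show (0 : E × E) = (0, 0) from rfl] at hPQ
    exact hPQ.curry_nhds
  -- This is the derivative of `P (Q (x, y), x) = P (x, y)` in `y` at `0`, in direction `v`; here `a
  -- x` plays the role of `Ad_x v`.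
  have key : (fun x => fderiv ℝ P (0, x) (a x, 0)) =ᶠ[𝓝 0] fun x => fderiv ℝ P (x, 0) (0, v) := by
    filter_upwards [hPQ', ti.eventually hQ, hQ0, ti.eventually hP1, tj.eventually hP1]
      with x h1 h2 h3 h4 h5
    have d1 := h4.hasFDerivAt.comp (0 : E) (hasFDerivAt_prodMk_right (𝕜 := ℝ) x (0 : E))
    have h5' := h5.hasFDerivAt
    rw [← h3] at h5'
    have d2 := h5'.comp (0 : E) ((hQd h2).prodMk (hasFDerivAt_const x (0 : E)))
    have e := DFunLike.congr_fun (d1.unique (d2.congr_of_eventuallyEq (h1.mono fun _ h => h.symm))) v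
    simp only [h3] at e
    simpa using e.symm
  refine ⟨fderiv ℝ a 0, had.hasFDerivAt.congr_of_eventuallyEq hae, fun X => ?_⟩
  have l1 : HasFDerivAt (fun x => fderiv ℝ P (0, x)) (B.comp (ContinuousLinearMap.inr ℝ E E)) 0 :=
    HasFDerivAt.comp (0 : E) hd2P (hasFDerivAt_prodMk_right (𝕜 := ℝ) (0 : E) (0 : E))
  have l2 := l1.clm_apply (had.hasFDerivAt.prodMk (hasFDerivAt_const (0 : E) (0 : E)))
  -- Differentiating `key` at `x = 0` gives `B (0, X) (v, 0) + a'(0) X = B (X, 0) (0, v)`, where `B`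
  -- is the second derivative of `P`. By symmetry of `B`, `a'(0) X` is the difference of second
  -- derivatives that defines the bracket.
  have e := DFunLike.congr_fun (l2.unique ((hV v).congr_of_eventuallyEq key)) X
  have sym : B (0, X) (v, 0) = B (v, 0) (0, X) :=
    (hP.isSymmSndFDerivAt (by
      rw [minSmoothness_of_isRCLikeNormedField]; exact ENat.LEInfty.out)) _ _
  have e0 : fderiv ℝ P ((0 : E), (0 : E)) (fderiv ℝ a 0 X, 0) = fderiv ℝ a 0 X := by
    have := fderiv_mul_zero_apply hP hl hr (fderiv ℝ a 0 X) 0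
    rwa [add_zero] at this
  rw [VectorField.lieBracket, (hV v).fderiv, (hV X).fderiv, hV0, hV0]
  simp [ha0, e0, sym] at e ⊢
  rw [← e]
  abel

end LocalGroup

/-! ### A chart centred at the unit -/

section UnitChart

open Filter Topology Set

variable {E : Type*} [NormedAddCommGroup E] [NormedSpace ℝ E]
  {M : Type*} [TopologicalSpace M] (I : ModelWithCorners ℝ E M)
  {G : Type*} [TopologicalSpace G] [ChartedSpace M G] [Group G]

variable (G) in
/-- A parametrisation of a neighbourhood of the unit, taking `0` to the unit. -/
noncomputable def unitParam (x : E) : G := (extChartAt I (1 : G)).symm (extChartAt I (1 : G) 1 + x)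

/-- A chart at the unit, taking the unit to `0`. -/
noncomputable def unitCoord (g : G) : E := extChartAt I (1 : G) g - extChartAt I (1 : G) 1

/-- The expression of a binary operation on `G` in the chart `unitCoord`. -/
noncomputable def inUnitChart (f : G × G → G) (p : E × E) : E :=
  unitCoord I (f (unitParam I G p.1, unitParam I G p.2))

variable (G) in
@[simp]
theorem unitParam_zero : unitParam I G 0 = 1 := by
  simp [unitParam]

@[simp]
theorem unitCoord_one : unitCoord I (1 : G) = 0 := by
  simp [unitCoord]

variable (G) in
theorem eventually_add_mem_target [I.Boundaryless] :
    ∀ᶠ x in 𝓝 (0 : E), extChartAt I (1 : G) 1 + x ∈ (extChartAt I (1 : G)).target := by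
  have : Tendsto (fun x : E => extChartAt I (1 : G) 1 + x) (𝓝 0) (𝓝 (extChartAt I (1 : G) 1)) :=
    (continuous_const.add continuous_id).tendsto' _ _ (by simp)
  exact this.eventually (extChartAt_target_mem_nhds (I := I) (1 : G))

variable (G) in
theorem eventually_unitCoord_unitParam [I.Boundaryless] :
    ∀ᶠ x in 𝓝 (0 : E), unitCoord I (unitParam I G x) = x := by
  filter_upwards [eventually_add_mem_target I G] with x hx
  rw [unitCoord, unitParam, (extChartAt I (1 : G)).right_inv hx, add_sub_cancel_left]

theorem eventually_unitParam_unitCoord :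
    ∀ᶠ g in 𝓝 (1 : G), unitParam I G (unitCoord I g) = g := by
  filter_upwards [extChartAt_source_mem_nhds (I := I) (1 : G)] with g hg
  rw [unitCoord, unitParam, add_sub_cancel, (extChartAt I (1 : G)).left_inv hg]

variable [LieGroup I ∞ G]

variable (G) in
theorem eventually_contMDiffAt_unitParam [I.Boundaryless] :
    ∀ᶠ x in 𝓝 (0 : E), ContMDiffAt 𝓘(ℝ, E) I ∞ (unitParam I G) x := by
  filter_upwards [eventually_add_mem_target I G] with x hx
  have h1 : ContMDiffAt 𝓘(ℝ, E) I ∞ (extChartAt I (1 : G)).symm (extChartAt I (1 : G) 1 + x) :=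
    (contMDiffOn_extChartAt_symm (1 : G)).contMDiffAt ((isOpen_extChartAt_target (1 : G)).mem_nhds hx)
  have h2 : ContMDiffAt 𝓘(ℝ, E) 𝓘(ℝ, E) ∞ (fun x : E => extChartAt I (1 : G) 1 + x) x :=
    (contDiffAt_const.add contDiffAt_id).contMDiffAt
  exact h1.comp x h2

theorem eventually_contMDiffAt_unitCoord :
    ∀ᶠ g in 𝓝 (1 : G), ContMDiffAt I 𝓘(ℝ, E) ∞ (unitCoord I) g := by
  filter_upwards [(chartAt M (1 : G)).open_source.mem_nhds (mem_chart_source M (1 : G))] with g hg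
  have h1 : ContMDiffAt I 𝓘(ℝ, E) ∞ (extChartAt I (1 : G)) g :=
    contMDiffOn_extChartAt.contMDiffAt ((chartAt M (1 : G)).open_source.mem_nhds hg)
  have h2 : ContMDiffAt 𝓘(ℝ, E) 𝓘(ℝ, E) ∞ (fun x : E => x - extChartAt I (1 : G) 1)
      (extChartAt I (1 : G) g) :=
    (contDiffAt_id.sub contDiffAt_const).contMDiffAt
  exact h2.comp g h1

variable (G) in
theorem tendsto_unitParam [I.Boundaryless] : Tendsto (unitParam I G) (𝓝 0) (𝓝 1) := by
  have := (eventually_contMDiffAt_unitParam I G).self_of_nhds.continuousAt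
  rwa [ContinuousAt, unitParam_zero] at this

theorem tendsto_unitCoord : Tendsto (unitCoord I) (𝓝 (1 : G)) (𝓝 0) := by
  have := (eventually_contMDiffAt_unitCoord I (G := G)).self_of_nhds.continuousAt
  rwa [ContinuousAt, unitCoord_one] at this

/-- The tangent space at `1` is identified with `E` through the very chart of which `unitCoord` is a
translate. Hence elements of `𝔤` can be read as vectors of `E` without any change of coordinates. -/
theorem hasMFDerivAt_unitCoord :
    HasMFDerivAt I 𝓘(ℝ, E) (unitCoord I) (1 : G) (ContinuousLinearMap.id ℝ E) := by
  refine ⟨(eventually_contMDiffAt_unitCoord I (G := G)).self_of_nhds.continuousAt, ?_⟩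
  have h : HasFDerivAt (fun x : E => x - extChartAt I (1 : G) 1) (ContinuousLinearMap.id ℝ E)
    (extChartAt I (1 : G) 1) := (hasFDerivAt_id _).sub_const _
  refine h.hasFDerivWithinAt.congr_of_eventuallyEq ?_ ?_
  · filter_upwards [extChartAt_target_mem_nhdsWithin (I := I) (1 : G)] with x hx
    change extChartAt I (1 : G) ((extChartAt I (1 : G)).symm x) - _ = _
    rw [(extChartAt I (1 : G)).right_inv hx]
  · change extChartAt I (1 : G) ((extChartAt I (1 : G)).symm _) - _ = _
    simp

variable (G) in
theorem hasMFDerivAt_unitParam [I.Boundaryless] :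
    HasMFDerivAt 𝓘(ℝ, E) I (unitParam I G) (0 : E) (ContinuousLinearMap.id ℝ E) := by
  refine ⟨(eventually_contMDiffAt_unitParam I G).self_of_nhds.continuousAt, ?_⟩
  have h : HasFDerivAt (fun x : E => extChartAt I (1 : G) 1 + x) (ContinuousLinearMap.id ℝ E)
    (0 : E) := (hasFDerivAt_id _).const_add _
  have h' := h.hasFDerivWithinAt (s := univ)
  simp only [writtenInExtChartAt, unitParam_zero, mfld_simps]
  refine h'.congr_of_eventuallyEq ?_ ?_
  · rw [nhdsWithin_univ]
    filter_upwards [eventually_add_mem_target I G] with x hx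
    exact (extChartAt I (1 : G)).right_inv hx
  · change extChartAt I (1 : G) (unitParam I G 0) = _
    simp

theorem tendsto_unitParam_prod [I.Boundaryless] :
    Tendsto (fun p : E × E => (unitParam I G p.1, unitParam I G p.2)) (𝓝 0) (𝓝 (1, 1)) :=
  ((tendsto_unitParam I G).comp (continuous_fst.tendsto' (0 : E × E) 0 rfl)).prodMk_nhds
    ((tendsto_unitParam I G).comp (continuous_snd.tendsto' (0 : E × E) 0 rfl))

theorem eventually_contDiffAt_inUnitChart [I.Boundaryless] {f : G × G → G}
    (hf : ContMDiff (I.prod I) I ∞ f) (h1 : f (1, 1) = 1) :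
    ∀ᶠ p in 𝓝 (0 : E × E), ContDiffAt ℝ ∞ (inUnitChart I f) p := by
  have t : Tendsto (fun p : E × E => f (unitParam I G p.1, unitParam I G p.2)) (𝓝 0) (𝓝 1) := by
    have := (hf.continuous.tendsto (1, 1)).comp (tendsto_unitParam_prod I (G := G))
    rwa [h1] at this
  have e := eventually_contMDiffAt_unitParam I G
  filter_upwards [t.eventually (eventually_contMDiffAt_unitCoord I),
    (continuous_fst.tendsto' (0 : E × E) 0 rfl).eventually e,
    (continuous_snd.tendsto' (0 : E × E) 0 rfl).eventually e] with p k1 k2 k3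
  rw [← contMDiffAt_iff_contDiffAt]
  have m1 : ContMDiffAt 𝓘(ℝ, E × E) I ∞ (fun p : E × E => unitParam I G p.1) p :=
    k2.comp p contDiffAt_fst.contMDiffAt
  have m2 : ContMDiffAt 𝓘(ℝ, E × E) I ∞ (fun p : E × E => unitParam I G p.2) p :=
    k3.comp p contDiffAt_snd.contMDiffAt
  exact k1.comp p (hf.contMDiffAt.comp p (m1.prodMk m2))

theorem eventually_unitParam_inUnitChart [I.Boundaryless] {f : G × G → G} (hf : Continuous f)
    (h1 : f (1, 1) = 1) : ∀ᶠ p in 𝓝 (0 : E × E),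
      unitParam I G (inUnitChart I f p) = f (unitParam I G p.1, unitParam I G p.2) := by
  have t : Tendsto (fun p : E × E => f (unitParam I G p.1, unitParam I G p.2)) (𝓝 0) (𝓝 1) := by
    have := (hf.tendsto (1, 1)).comp (tendsto_unitParam_prod I (G := G))
    rwa [h1] at this
  exact t.eventually (eventually_unitParam_unitCoord I)

end UnitChart

/-! ### The group operations in the chart -/

section LocalOperations

open Filter Topology Set

variable {E : Type*} [NormedAddCommGroup E] [NormedSpace ℝ E]
  {M : Type*} [TopologicalSpace M] (I : ModelWithCorners ℝ E M)
  (G : Type*) [TopologicalSpace G] [ChartedSpace M G] [Group G] [LieGroup I ∞ G]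

/-- The product in the chart `unitCoord`. -/
noncomputable def localMul : E × E → E := inUnitChart I fun p : G × G => p.1 * p.2

/-- The conjugation `(x, y) ↦ x y x⁻¹` in the chart `unitCoord`. -/
noncomputable def localConj : E × E → E := inUnitChart I fun p : G × G => p.1 * p.2 * p.1⁻¹

/-- The division `(x, y) ↦ x y⁻¹` in the chart `unitCoord`. -/
noncomputable def localDiv : E × E → E := inUnitChart I fun p : G × G => p.1 * p.2⁻¹

theorem contMDiff_mul_inv_pair :
    ContMDiff (I.prod I) I ∞ fun p : G × G => p.1 * p.2⁻¹ :=
  contMDiff_fst.mul contMDiff_snd.inv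

theorem contMDiff_conj_pair :
    ContMDiff (I.prod I) I ∞ fun p : G × G => p.1 * p.2 * p.1⁻¹ :=
  (contMDiff_fst.mul contMDiff_snd).mul contMDiff_fst.inv

variable [I.Boundaryless]

theorem eventually_contDiffAt_localMul :
    ∀ᶠ p in 𝓝 (0 : E × E), ContDiffAt ℝ ∞ (localMul I G) p :=
  eventually_contDiffAt_inUnitChart I (contMDiff_mul I ∞) (one_mul 1)

theorem eventually_contDiffAt_localConj :
    ∀ᶠ p in 𝓝 (0 : E × E), ContDiffAt ℝ ∞ (localConj I G) p :=
  eventually_contDiffAt_inUnitChart I (contMDiff_conj_pair I G) (by simp)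

theorem eventually_contDiffAt_localDiv :
    ∀ᶠ p in 𝓝 (0 : E × E), ContDiffAt ℝ ∞ (localDiv I G) p :=
  eventually_contDiffAt_inUnitChart I (contMDiff_mul_inv_pair I G) (by simp)

theorem eventually_unitParam_localMul : ∀ᶠ p in 𝓝 (0 : E × E),
    unitParam I G (localMul I G p) = unitParam I G p.1 * unitParam I G p.2 :=
  eventually_unitParam_inUnitChart I (contMDiff_mul I ∞).continuous (one_mul 1)

theorem eventually_unitParam_localConj : ∀ᶠ p in 𝓝 (0 : E × E),
    unitParam I G (localConj I G p) =
      unitParam I G p.1 * unitParam I G p.2 * (unitParam I G p.1)⁻¹ :=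
  eventually_unitParam_inUnitChart I (contMDiff_conj_pair I G).continuous (by simp)

theorem eventually_unitParam_localDiv : ∀ᶠ p in 𝓝 (0 : E × E),
    unitParam I G (localDiv I G p) = unitParam I G p.1 * (unitParam I G p.2)⁻¹ :=
  eventually_unitParam_inUnitChart I (contMDiff_mul_inv_pair I G).continuous (by simp)

omit [LieGroup I ∞ G] in
theorem eventually_localMul_zero_right : ∀ᶠ x in 𝓝 (0 : E), localMul I G (x, 0) = x := by
  filter_upwards [eventually_unitCoord_unitParam I G] with x hx
  simpa [localMul, inUnitChart] using hx

omit [LieGroup I ∞ G] in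
theorem eventually_localMul_zero_left : ∀ᶠ x in 𝓝 (0 : E), localMul I G (0, x) = x := by
  filter_upwards [eventually_unitCoord_unitParam I G] with x hx
  simpa [localMul, inUnitChart] using hx

omit [LieGroup I ∞ G] in
theorem eventually_localConj_zero_left : ∀ᶠ x in 𝓝 (0 : E), localConj I G (0, x) = x := by
  filter_upwards [eventually_unitCoord_unitParam I G] with x hx
  simpa [localConj, inUnitChart] using hx

omit [LieGroup I ∞ G] [I.Boundaryless] in
theorem localConj_zero_right (x : E) : localConj I G (x, 0) = 0 := by
  simp [localConj, inUnitChart]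

omit [LieGroup I ∞ G] [I.Boundaryless] in
theorem localDiv_self (x : E) : localDiv I G (x, x) = 0 := by
  simp [localDiv, inUnitChart]

theorem eventually_localMul_assoc : ∀ᶠ p in 𝓝 (0 : (E × E) × E),
    localMul I G (localMul I G p.1, p.2) = localMul I G (p.1.1, localMul I G (p.1.2, p.2)) := by
  have t1 : Tendsto (fun p : (E × E) × E => p.1) (𝓝 0) (𝓝 0) := continuous_fst.tendsto' _ _ rfl
  have t2 : Tendsto (fun p : (E × E) × E => (p.1.2, p.2)) (𝓝 0) (𝓝 0) :=
    (Continuous.prodMk (by fun_prop) (by fun_prop)).tendsto' _ _ rfl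
  filter_upwards [t1.eventually (eventually_unitParam_localMul I G),
    t2.eventually (eventually_unitParam_localMul I G)] with p h1 h2
  change unitCoord I (unitParam I G (localMul I G p.1) * unitParam I G p.2) =
    unitCoord I (unitParam I G p.1.1 * unitParam I G (localMul I G (p.1.2, p.2)))
  rw [h1, h2, mul_assoc]

/-- The identity `(x y x⁻¹) x = x y` determines conjugation by the product alone, so inversion need
not be differentiated in `exists_hasFDerivAt_conj`. -/
theorem eventually_localMul_localConj : ∀ᶠ p in 𝓝 (0 : E × E),
    localMul I G (localConj I G p, p.1) = localMul I G p := by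
  filter_upwards [eventually_unitParam_localConj I G] with p h1
  change unitCoord I (unitParam I G (localConj I G p) * unitParam I G p.1) =
    unitCoord I (unitParam I G p.1 * unitParam I G p.2)
  rw [h1, inv_mul_cancel_right]

end LocalOperations

/-! ### The derivative of `Ad` is the Lie bracket -/

section Adjoint

open Filter Topology Set VectorField

variable {E : Type*} [NormedAddCommGroup E] [NormedSpace ℝ E]
  {M : Type*} [TopologicalSpace M] (I : ModelWithCorners ℝ E M)
  {G : Type*} [TopologicalSpace G] [ChartedSpace M G] [Group G]

theorem mlieBracket_self_eq_lieBracket (V W : E → E) (x : E) :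
    mlieBracket 𝓘(ℝ, E) V W x = lieBracket ℝ V W x :=
  (congrFun (mlieBracketWithin_eq_lieBracketWithin (s := univ)) x).trans
    (congrFun lieBracketWithin_univ x)

/-- The adjoint action of `g` on the Lie algebra. -/
noncomputable def AdMap (g : G) : GroupLieAlgebra I G →ₗ[ℝ] GroupLieAlgebra I G :=
  tangentAt I I (fun z : G => g * z * g⁻¹) (x := 1) (y := 1) (by simp)

theorem AdBivector_eq_map (g : G) : AdBivector I g = exteriorPower.map 2 (AdMap I g) := rfl

variable [LieGroup I ∞ G] [I.Boundaryless]

/-- No smallness of `x` is needed: conjugation fixes the unit, and both chart maps have identity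
derivative there. -/
theorem AdMap_unitParam (x : E) (v : E) :
    (AdMap I (unitParam I G x) v : E) = fderiv ℝ (fun y => localConj I G (x, y)) 0 v := by
  set g := unitParam I G x
  have m : MDifferentiableAt I I (fun z : G => g * z * g⁻¹) (unitParam I G 0) :=
    mdifferentiable_mul_mul g g⁻¹ _
  have h1 := m.hasMFDerivAt.comp (0 : E) (hasMFDerivAt_unitParam I G)
  have h2 : HasMFDerivAt I 𝓘(ℝ, E) (unitCoord I) (g * unitParam I G 0 * g⁻¹)
      (ContinuousLinearMap.id ℝ E) := by
    have := hasMFDerivAt_unitCoord I (G := G)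
    rwa [show (1 : G) = g * unitParam I G 0 * g⁻¹ by simp] at this
  have h3 : HasFDerivAt (fun y => localConj I G (x, y)) ((ContinuousLinearMap.id ℝ E).comp
      ((mfderiv I I (fun z : G => g * z * g⁻¹) (unitParam I G 0) : E →L[ℝ] E).comp
        (ContinuousLinearMap.id ℝ E))) 0 := (h2.comp (0 : E) h1).hasFDerivAt
  have h4 := DFunLike.congr_fun h3.fderiv v
  refine Eq.trans ?_ h4.symm
  change (mfderiv I I (fun z : G => g * z * g⁻¹) 1 : E →L[ℝ] E) v =
    (mfderiv I I (fun z : G => g * z * g⁻¹) (unitParam I G 0) : E →L[ℝ] E) v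
  rw [unitParam_zero]

/-- Near the unit the inverse of the derivative of `unitParam` is the derivative of `unitCoord`;
composed with that of left translation it is a partial derivative of `localMul`. -/
theorem eventually_mpullback_mulInvariantVectorField (X : GroupLieAlgebra I G) :
    ∀ᶠ x in 𝓝 (0 : E), (mpullback 𝓘(ℝ, E) I (unitParam I G) (mulInvariantVectorField X) x : E) =
      fderiv ℝ (localMul I G) (x, 0) (0, (X : E)) := by
  have ti : Tendsto (fun x : E => (x, (0 : E))) (𝓝 0) (𝓝 (0 : E × E)) :=
    (Continuous.prodMk_left (0 : E)).tendsto' _ _ rfl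
  filter_upwards [ti.eventually (eventually_contDiffAt_localMul I G),
    eventually_contMDiffAt_unitParam I G,
    (tendsto_unitParam I G).eventually (eventually_contMDiffAt_unitCoord I),
    eventually_eventually_nhds.2 (eventually_unitCoord_unitParam I G),
    (tendsto_unitParam I G).eventually
      (eventually_eventually_nhds.2 (eventually_unitParam_unitCoord I))]
    with x k1 k2 k3 k4 k5
  change unitCoord I ∘ unitParam I G =ᶠ[𝓝 x] id at k4
  change unitParam I G ∘ unitCoord I =ᶠ[𝓝 (unitParam I G x)] id at k5
  set g := unitParam I G x with hg
  have d1 : HasMFDerivAt 𝓘(ℝ, E) I (unitParam I G) x (mfderiv 𝓘(ℝ, E) I (unitParam I G) x) :=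
    (k2.mdifferentiableAt (by simp)).hasMFDerivAt
  have d2 : HasMFDerivAt I 𝓘(ℝ, E) (unitCoord I) g (mfderiv I 𝓘(ℝ, E) (unitCoord I) g) :=
    (k3.mdifferentiableAt (by simp)).hasMFDerivAt
  have d1' : HasMFDerivAt 𝓘(ℝ, E) I (unitParam I G) (unitCoord I g)
      (mfderiv 𝓘(ℝ, E) I (unitParam I G) x) := by
    rw [hg, show unitCoord I (unitParam I G x) = x from k4.self_of_nhds]
    exact d1
  set A : E →L[ℝ] E := mfderiv 𝓘(ℝ, E) I (unitParam I G) x with hA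
  set B : E →L[ℝ] E := mfderiv I 𝓘(ℝ, E) (unitCoord I) g with hB
  have e1 : B.comp A = ContinuousLinearMap.id ℝ E :=
    hasMFDerivAt_unique (d2.comp x d1)
      ((hasMFDerivAt_id x).congr_of_eventuallyEq k4)
  have e2 : A.comp B = ContinuousLinearMap.id ℝ E :=
    hasMFDerivAt_unique (d1'.comp g d2)
      ((hasMFDerivAt_id g).congr_of_eventuallyEq k5)
  have e3 : A.inverse = B := ContinuousLinearMap.inverse_eq e2 e1
  have m : MDifferentiableAt I I (fun z : G => g * z) (unitParam I G 0) :=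
    mdifferentiable_mul_left' g _
  have h1 := m.hasMFDerivAt.comp (0 : E) (hasMFDerivAt_unitParam I G)
  have h2 : HasMFDerivAt I 𝓘(ℝ, E) (unitCoord I) (g * unitParam I G 0) B := by
    rw [unitParam_zero, mul_one]
    exact d2
  have h3 : HasFDerivAt (fun y => localMul I G (x, y)) (B.comp
      ((mfderiv I I (fun z : G => g * z) (unitParam I G 0) : E →L[ℝ] E).comp
        (ContinuousLinearMap.id ℝ E))) 0 := (h2.comp (0 : E) h1).hasFDerivAt
  have h4 := (k1.differentiableAt (by simp)).hasFDerivAt.comp (0 : E)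
    (hasFDerivAt_prodMk_right (𝕜 := ℝ) x (0 : E))
  have h5 := DFunLike.congr_fun (h4.unique h3) X
  refine Eq.trans ?_ h5.symm
  change A.inverse ((mfderiv I I (fun z : G => g * z) 1 : E →L[ℝ] E) X) =
    B ((mfderiv I I (fun z : G => g * z) (unitParam I G 0) : E →L[ℝ] E) X)
  rw [unitParam_zero, e3]

variable [FiniteDimensional ℝ E]

/-- The bracket of `𝔤` is the value at `1` of the bracket of left invariant fields. Brackets commute
with the pullback by `unitParam`, whose derivative at `0` is the identity. -/
theorem adMap_eq_lieBracket (X Y : GroupLieAlgebra I G) :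
    (adMap I X Y : E) = lieBracket ℝ (fun x => fderiv ℝ (localMul I G) (x, 0) (0, (X : E)))
      (fun x => fderiv ℝ (localMul I G) (x, 0) (0, (Y : E))) 0 := by
  have : CompleteSpace E := FiniteDimensional.complete ℝ E
  have : LieGroup I (minSmoothness ℝ 3) G := LieGroup.of_le (n := ∞) (by
    rw [minSmoothness_of_isRCLikeNormedField]; exact ENat.LEInfty.out)
  have : IsManifold I (minSmoothness ℝ 2) G := IsManifold.of_le (n := ∞) (by
    rw [minSmoothness_of_isRCLikeNormedField]; exact ENat.LEInfty.out)
  have h := mpullback_mlieBracket (I := 𝓘(ℝ, E)) (I' := I) (n := ∞) (f := unitParam I G)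
    (V := mulInvariantVectorField X) (W := mulInvariantVectorField Y) (x₀ := (0 : E))
    (mdifferentiableAt_mulInvariantVectorField X) (mdifferentiableAt_mulInvariantVectorField Y)
    (eventually_contMDiffAt_unitParam I G).self_of_nhds (by
      rw [minSmoothness_of_isRCLikeNormedField]; exact ENat.LEInfty.out)
  have h2 : mlieBracket 𝓘(ℝ, E) (mpullback 𝓘(ℝ, E) I (unitParam I G) (mulInvariantVectorField X))
      (mpullback 𝓘(ℝ, E) I (unitParam I G) (mulInvariantVectorField Y)) (0 : E) =
      mlieBracket 𝓘(ℝ, E) (fun x : E => fderiv ℝ (localMul I G) (x, 0) (0, (X : E)))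
        (fun x : E => fderiv ℝ (localMul I G) (x, 0) (0, (Y : E))) (0 : E) :=
    Filter.EventuallyEq.mlieBracket_vectorField_eq
      (eventually_mpullback_mulInvariantVectorField I X)
      (eventually_mpullback_mulInvariantVectorField I Y)
  have h := (h.trans h2).trans (mlieBracket_self_eq_lieBracket _ _ _)
  refine Eq.trans ?_ h
  set W : ∀ g : G, TangentSpace I g :=
    mlieBracket I (mulInvariantVectorField X) (mulInvariantVectorField Y) with hW
  change (W 1 : E) = (mfderiv 𝓘(ℝ, E) I (unitParam I G) 0 : E →L[ℝ] E).inverse (W (unitParam I G 0))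
  have e : (mfderiv 𝓘(ℝ, E) I (unitParam I G) 0 : E →L[ℝ] E) = ContinuousLinearMap.id ℝ E :=
    (hasMFDerivAt_unitParam I G).mfderiv
  have inv (A : E →L[ℝ] E) (hA : A = ContinuousLinearMap.id ℝ E) (w : E) : A.inverse w = w := by
    rw [hA, ContinuousLinearMap.inverse_id]; rfl
  refine Eq.trans ?_ (inv _ e _).symm
  have : (fun g : G => (W g : E)) 1 = (fun g : G => (W g : E)) (unitParam I G 0) := by
    rw [unitParam_zero]
  exact this

/-- The derivative of the adjoint action along a curve through the unit is the Lie bracket. -/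
theorem hasDerivAt_AdMap {γ : ℝ → G} (h0 : γ 0 = 1) (hγ : MDifferentiableAt 𝓘(ℝ, ℝ) I γ 0)
    (v : GroupLieAlgebra I G) :
    HasDerivAt (fun t => (AdMap I (γ t) v : E))
      (adMap I (tangentAt 𝓘(ℝ, ℝ) I γ h0 (1 : ℝ)) v : E) 0 := by
  obtain ⟨D, hD, hDX⟩ := exists_hasFDerivAt_conj
    (eventually_contDiffAt_localMul I G).self_of_nhds (eventually_contDiffAt_localConj I G)
    (eventually_localMul_zero_right I G) (eventually_localMul_zero_left I G)
    (Eventually.of_forall (localConj_zero_right I G)) (eventually_localConj_zero_left I G)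
    (eventually_localMul_localConj I G) v
  set X : E := tangentAt 𝓘(ℝ, ℝ) I γ h0 (1 : ℝ) with hX
  have e : (adMap I X v : E) = D X := (adMap_eq_lieBracket I X v).trans (hDX X).symm
  change HasDerivAt (fun t => (AdMap I (γ t) v : E)) (adMap I X v : E) 0
  rw [e]
  have hc : HasMFDerivAt I 𝓘(ℝ, E) (unitCoord I) (γ 0) (ContinuousLinearMap.id ℝ E) := by
    rw [h0]
    exact hasMFDerivAt_unitCoord I
  have h1 : HasFDerivAt (unitCoord I ∘ γ) ((ContinuousLinearMap.id ℝ E).comp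
      (mfderiv 𝓘(ℝ, ℝ) I γ 0 : ℝ →L[ℝ] E)) 0 := (hc.comp (0 : ℝ) hγ.hasMFDerivAt).hasFDerivAt
  have h2 := h1.hasDerivAt
  have hD' : HasFDerivAt (fun x => fderiv ℝ (fun y => localConj I G (x, y)) 0 (v : E)) D
      ((unitCoord I ∘ γ) 0) := by
    simp only [Function.comp, h0, unitCoord_one]
    exact hD
  have h3 := hD'.comp_hasDerivAt (0 : ℝ) h2
  refine h3.congr_of_eventuallyEq ?_
  have hγ0 : Tendsto γ (𝓝 0) (𝓝 1) := by
    have := hγ.continuousAt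
    rwa [ContinuousAt, h0] at this
  filter_upwards [hγ0.eventually (eventually_unitParam_unitCoord I)] with t ht
  have := AdMap_unitParam I (G := G) (unitCoord I (γ t)) v
  rw [ht] at this
  exact this

end Adjoint

/-! ### Differentiating the induced action on bivectors -/

section ExteriorDerivative

variable {E : Type*} [NormedAddCommGroup E] [NormedSpace ℝ E]

theorem exteriorPower_map_wedge {V W : Type*} [AddCommGroup V] [Module ℝ V] [AddCommGroup W]
    [Module ℝ W] (f : V →ₗ[ℝ] W) (u v : V) :
    exteriorPower.map 2 f (wedge u v) = wedge (f u) (f v) := by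
  rw [wedge, wedge, exteriorPower.map_apply_ιMulti]
  congr 1
  ext i
  fin_cases i <;> rfl

theorem bivector_induction {V : Type*} [AddCommGroup V] [Module ℝ V] {p : ⋀[ℝ]^2 V → Prop}
    (wedge : ∀ u v, p (wedge u v)) (zero : p 0) (add : ∀ a b, p a → p b → p (a + b))
    (smul : ∀ (c : ℝ) a, p a → p (c • a)) (s : ⋀[ℝ]^2 V) : p s := by
  have hs : s ∈ Submodule.span ℝ (Set.range (exteriorPower.ιMulti ℝ 2 (M := V))) := by
    rw [exteriorPower.ιMulti_span]; trivial
  induction hs using Submodule.span_induction with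
  | mem x hx =>
    obtain ⟨m, rfl⟩ := hx
    have : m = ![m 0, m 1] := by ext i; fin_cases i <;> rfl
    rw [this]
    exact wedge _ _
  | zero => exact zero
  | add a b _ _ ha hb => exact add a b ha hb
  | smul c a _ ha => exact smul c a ha

/-- If `B` is a curve of endomorphisms through the identity with velocity `D`, then the induced
curve of endomorphisms of `⋀² V` has velocity the derivation extending `D`. -/
theorem hasDerivAt_dual_exteriorPower_map [FiniteDimensional ℝ E] {V : Type*} [AddCommGroup V]
    [Module ℝ V] (φ : V ≃ₗ[ℝ] E) {B : ℝ → V →ₗ[ℝ] V} {D : V →ₗ[ℝ] V}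
    (hB : ∀ v, HasDerivAt (fun t => φ (B t v)) (φ (D v)) 0) (hB0 : B 0 = LinearMap.id)
    (ℓ : Module.Dual ℝ (⋀[ℝ]^2 V)) (s : ⋀[ℝ]^2 V) :
    HasDerivAt (fun t => ℓ (exteriorPower.map 2 (B t) s)) (ℓ (derivBivector D s)) 0 := by
  induction s using bivector_induction with
  | wedge u v =>
    -- Testing with `ℓ` avoids a topology on `⋀² V`: `ℓ (u ∧ v)` becomes a bilinear form on `E`,
    -- continuous by finite dimension, to which the product rule applies.
    let β : E →ₗ[ℝ] E →ₗ[ℝ] ℝ := LinearMap.mk₂ ℝ (fun u v => ℓ (wedge (φ.symm u) (φ.symm v)))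
      (by simp [wedge_add_left]) (by simp [wedge_smul_left])
      (by simp [wedge_add_right]) (by simp [wedge_smul_right])
    let β' : E →L[ℝ] E →L[ℝ] ℝ := LinearMap.toContinuousLinearMap
      (LinearMap.toContinuousLinearMap.toLinearMap ∘ₗ β)
    have hβ (u v : V) : β' (φ u) (φ v) = ℓ (wedge u v) := by
      change ℓ (wedge (φ.symm (φ u)) (φ.symm (φ v))) = _
      simp
    have h : HasDerivAt (fun t => β' (φ (B t u)) (φ (B t v))) _ 0 :=
      (β'.hasFDerivAt.comp_hasDerivAt (0 : ℝ) (hB u)).clm_apply (hB v)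
    simp only [Function.comp, hB0, LinearMap.id_apply, hβ] at h
    simpa only [exteriorPower_map_wedge, derivBivector_wedge, map_add] using h
  | zero => simpa using hasDerivAt_const (0 : ℝ) (0 : ℝ)
  | add a b ha hb => simp only [map_add]; exact ha.add hb
  | smul c a ha => simpa using! ha.const_mul c

end ExteriorDerivative

/-! ### Invariance modulo `𝔥 ∧ 𝔤` under `H` and under `𝔥` -/

section Invariance

variable {E : Type*} [NormedAddCommGroup E] [NormedSpace ℝ E]
  {M : Type*} [TopologicalSpace M] {I : ModelWithCorners ℝ E M}
  {G : Type*} [TopologicalSpace G] [ChartedSpace M G] [Group G]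

theorem AdMap_one : AdMap I (1 : G) = LinearMap.id := by
  have h : (fun z : G => 1 * z * 1⁻¹) = id := by ext; simp
  unfold AdMap tangentAt
  ext v
  have key (f : G → G) (hf : f = id) : (mfderiv I I f 1 : E →L[ℝ] E) v = v := by
    subst hf
    exact congrArg (fun L : E →L[ℝ] E => L v) (mfderiv_id (I := I) (x := (1 : G)))
  exact key _ h

variable [LieGroup I ∞ G]

/-- Conjugating a curve in `H` by `h ∈ H` gives a curve in `H`. -/
theorem AdMap_mem_subgroupLieAlgebra {H : Subgroup G} {h : G} (hh : h ∈ H)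
    {X : GroupLieAlgebra I G} (hX : X ∈ subgroupLieAlgebra I H) :
    AdMap I h X ∈ subgroupLieAlgebra I H := by
  obtain ⟨γ, h0, hγ, hH, rfl⟩ := hX
  refine ⟨fun t => h * γ t * h⁻¹, by simp [h0],
    (contMDiff_const.mul hγ).mul contMDiff_const,
    fun t => H.mul_mem (H.mul_mem hh (hH t)) (H.inv_mem hh), ?_⟩
  have h1 : HasMFDerivAt 𝓘(ℝ, ℝ) I γ 0 (mfderiv 𝓘(ℝ, ℝ) I γ 0) :=
    (hγ.mdifferentiable (by simp) 0).hasMFDerivAt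
  have h2 : HasMFDerivAt I I (fun z : G => h * z * h⁻¹) (γ 0)
      (mfderiv I I (fun z : G => h * z * h⁻¹) (γ 0)) :=
    (mdifferentiable_mul_mul h h⁻¹ _).hasMFDerivAt
  have h3 := (h2.comp (0 : ℝ) h1).mfderiv
  refine (congrArg (fun L : ℝ →L[ℝ] E => L 1) h3).trans ?_
  change (mfderiv I I (fun z : G => h * z * h⁻¹) (γ 0) : E →L[ℝ] E) _ =
    (mfderiv I I (fun z : G => h * z * h⁻¹) 1 : E →L[ℝ] E) _
  rw [h0]
  rfl

theorem AdBivector_mem_wedgeTop {H : Subgroup G} {h : G} (hh : h ∈ H)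
    {w : ⋀[ℝ]^2 (GroupLieAlgebra I G)} (hw : w ∈ wedgeTop (subgroupLieAlgebra I H)) :
    AdBivector I h w ∈ wedgeTop (subgroupLieAlgebra I H) := by
  unfold wedgeTop at hw
  induction hw using Submodule.span_induction with
  | mem x hx =>
    obtain ⟨u, hu, v, rfl⟩ := hx
    rw [AdBivector_eq_map, exteriorPower_map_wedge]
    exact Submodule.subset_span ⟨_, AdMap_mem_subgroupLieAlgebra hh hu, _, rfl⟩
  | zero => rw [map_zero]; exact Submodule.zero_mem _
  | add a b _ _ ha hb => rw [map_add]; exact Submodule.add_mem _ ha hb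
  | smul c a _ ha => rw [map_smul]; exact Submodule.smul_mem _ c ha

/-- The elements of `H` which fix `s` modulo `𝔥 ∧ 𝔤`. -/
noncomputable def stabilizerMod (H : Subgroup G) (s : ⋀[ℝ]^2 (GroupLieAlgebra I G)) :
    Subgroup G where
  carrier := {h | h ∈ H ∧ AdBivector I h s - s ∈ wedgeTop (subgroupLieAlgebra I H)}
  one_mem' := ⟨H.one_mem, by rw [AdBivector_one, sub_self]; exact Submodule.zero_mem _⟩
  mul_mem' := by
    rintro a b ⟨ha, ha'⟩ ⟨hb, hb'⟩
    refine ⟨H.mul_mem ha hb, ?_⟩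
    -- `Ad_{ab} s - s = Ad_a (Ad_b s - s) + (Ad_a s - s)`.
    have := Submodule.add_mem _ (AdBivector_mem_wedgeTop ha hb') ha'
    rwa [map_sub, ← AdBivector_mul, sub_add_sub_cancel] at this
  inv_mem' := by
    rintro a ⟨ha, ha'⟩
    refine ⟨H.inv_mem ha, ?_⟩
    have := Submodule.neg_mem _ (AdBivector_mem_wedgeTop (H.inv_mem ha) ha')
    rwa [map_sub, ← AdBivector_mul, inv_mul_cancel, AdBivector_one, neg_sub] at this

variable [I.Boundaryless] [FiniteDimensional ℝ E]

theorem hasDerivAt_dual_AdBivector {γ : ℝ → G} (h0 : γ 0 = 1)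
    (hγ : MDifferentiableAt 𝓘(ℝ, ℝ) I γ 0) (ℓ : Module.Dual ℝ (⋀[ℝ]^2 (GroupLieAlgebra I G)))
    (s : ⋀[ℝ]^2 (GroupLieAlgebra I G)) :
    HasDerivAt (fun t => ℓ (AdBivector I (γ t) s))
      (ℓ (adBivector I (tangentAt 𝓘(ℝ, ℝ) I γ h0 (1 : ℝ)) s)) 0 :=
  hasDerivAt_dual_exteriorPower_map (E := E) (V := GroupLieAlgebra I G) (LinearEquiv.refl ℝ E)
    (B := fun t => AdMap I (γ t))
    (D := adMap I (tangentAt 𝓘(ℝ, ℝ) I γ h0 (1 : ℝ))) (hasDerivAt_AdMap I h0 hγ)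
    (by rw [h0]; exact AdMap_one) ℓ s

/-- If `s` is `H`-invariant modulo `𝔥 ∧ 𝔤`, then it is `𝔥`-invariant modulo `𝔥 ∧ 𝔤`. -/
theorem adBivector_mem_wedgeTop {H : Subgroup G} {s : ⋀[ℝ]^2 (GroupLieAlgebra I G)}
    (hs : ∀ h ∈ H, AdBivector I h s - s ∈ wedgeTop (subgroupLieAlgebra I H))
    {X : GroupLieAlgebra I G} (hX : X ∈ subgroupLieAlgebra I H) :
    adBivector I X s ∈ wedgeTop (subgroupLieAlgebra I H) := by
  obtain ⟨γ, h0, hγ, hH, rfl⟩ := hX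
  -- A subspace is the common kernel of the functionals that annihilate it; for such `ℓ`, `ℓ
  -- (Ad_{γ(t)} s)` is constant.
  rw [← Subspace.forall_mem_dualAnnihilator_apply_eq_zero_iff]
  intro ℓ hℓ
  have h1 := hasDerivAt_dual_AdBivector h0 (hγ.mdifferentiable (by simp) 0) ℓ s
  have h2 : (fun t => ℓ (AdBivector I (γ t) s)) = fun _ => ℓ s := by
    funext t
    have := (Submodule.mem_dualAnnihilator ℓ).1 hℓ _ (hs (γ t) (hH t))
    rwa [map_sub, sub_eq_zero] at this
  rw [h2] at h1
  exact h1.unique (hasDerivAt_const 0 _)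

/-- If `s` is `𝔥`-invariant modulo `𝔥 ∧ 𝔤`, then it is invariant modulo `𝔥 ∧ 𝔤` under the
elements of `H` which can be joined to `1` by a smooth curve in `H`. -/
theorem curve_mem_stabilizerMod {H : Subgroup G} {s : ⋀[ℝ]^2 (GroupLieAlgebra I G)}
    (hs : ∀ X ∈ subgroupLieAlgebra I H, adBivector I X s ∈ wedgeTop (subgroupLieAlgebra I H))
    {γ : ℝ → G} (h0 : γ 0 = 1) (hγ : ContMDiff 𝓘(ℝ, ℝ) I ∞ γ) (hH : ∀ t, γ t ∈ H) (t : ℝ) :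
    γ t ∈ stabilizerMod H s := by
  refine ⟨hH t, ?_⟩
  rw [← Subspace.forall_mem_dualAnnihilator_apply_eq_zero_iff]
  intro ℓ hℓ
  have hd (t : ℝ) : HasDerivAt (fun t => ℓ (AdBivector I (γ t) s)) 0 t := by
    -- Writing `γ(t + τ) = γ(t) δ(τ)` with `δ` a curve in `H` through `1`, the derivative at `t` is
    -- `ℓ (Ad_{γ(t)} (ad_X s))` with `X = δ'(0) ∈ 𝔥`. It vanishes because `Ad_{γ(t)}` preserves `𝔥 ∧
    -- 𝔤`.
    have δs : ContMDiff 𝓘(ℝ, ℝ) I ∞ (fun τ => (γ t)⁻¹ * γ (t + τ)) :=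
      contMDiff_const.mul (hγ.comp (contDiff_const.add contDiff_id).contMDiff)
    have δ0 : (γ t)⁻¹ * γ (t + 0) = 1 := by simp
    have h1 := hasDerivAt_dual_AdBivector (γ := fun τ => (γ t)⁻¹ * γ (t + τ)) δ0
      (δs.mdifferentiable (by simp) 0) (ℓ ∘ₗ AdBivector I (γ t)) s
    have h2 := AdBivector_mem_wedgeTop (hH t) (hs _ ⟨_, δ0, δs,
      fun τ => H.mul_mem (H.inv_mem (hH t)) (hH (t + τ)), rfl⟩)
    have h3 := (Submodule.mem_dualAnnihilator ℓ).1 hℓ _ h2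
    have h4 : HasDerivAt (fun τ => ℓ (AdBivector I (γ (t + τ)) s)) _ 0 :=
      h1.congr_of_eventuallyEq (Filter.Eventually.of_forall fun τ => by
        simp only [LinearMap.comp_apply, ← AdBivector_mul, mul_inv_cancel_left])
    rw [LinearMap.comp_apply, h3] at h4
    have h5 := HasDerivAt.comp_sub_const (x := t) (a := t) (by rwa [sub_self])
      (f := fun τ => ℓ (AdBivector I (γ (t + τ)) s))
    simpa using h5
  have := is_const_of_deriv_eq_zero (fun t => (hd t).differentiableAt) (fun t => (hd t).deriv) t 0
  simp only [h0, AdBivector_one] at this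
  rw [map_sub, this, sub_self]

end Invariance

/-! ### Limit directions of a closed subgroup -/

section ClosedSubgroup

open Filter Topology Set

theorem exists_norm_sub_le_of_contDiffAt {F F' : Type*} [NormedAddCommGroup F] [NormedSpace ℝ F]
    [NormedAddCommGroup F'] [NormedSpace ℝ F'] {f : F → F'} {a : F} (hf : ContDiffAt ℝ 1 f a) :
    ∃ L : ℝ, 0 ≤ L ∧ ∃ ρ > 0, ∀ p ∈ Metric.ball a ρ, ∀ q ∈ Metric.ball a ρ,
      ‖f p - f q‖ ≤ L * ‖p - q‖ := by
  obtain ⟨K, t, ht, hK⟩ := hf.exists_lipschitzOnWith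
  obtain ⟨ρ, hρ, hρt⟩ := Metric.mem_nhds_iff.1 ht
  exact ⟨K, K.2, ρ, hρ, fun p hp q hq => by
    simpa [dist_eq_norm] using hK.dist_le_mul p (hρt hp) q (hρt hq)⟩

variable {E : Type*} [NormedAddCommGroup E] [NormedSpace ℝ E]
  {M : Type*} [TopologicalSpace M] (I : ModelWithCorners ℝ E M)
  (G : Type*) [TopologicalSpace G] [ChartedSpace M G] [Group G] [LieGroup I ∞ G] [I.Boundaryless]

/-- Quantitative estimates for the operations of a Lie group in a chart at the unit. -/
theorem exists_local_estimates : ∃ L : ℝ, 0 ≤ L ∧ ∃ ρ > 0, ∀ a b : E, ‖a‖ < ρ → ‖b‖ < ρ →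
    ContMDiffAt 𝓘(ℝ, E) I ∞ (unitParam I G) a ∧
    unitParam I G (localMul I G (a, b)) = unitParam I G a * unitParam I G b ∧
    unitParam I G (localConj I G (a, b)) =
      unitParam I G a * unitParam I G b * (unitParam I G a)⁻¹ ∧
    unitParam I G (localDiv I G (a, b)) = unitParam I G a * (unitParam I G b)⁻¹ ∧
    ‖localMul I G (a, b)‖ ≤ ‖a‖ + L * ‖b‖ ∧ ‖localConj I G (a, b)‖ ≤ L * ‖b‖ ∧
    ‖localDiv I G (a, b)‖ ≤ L * ‖a - b‖ := by
  have one : (1 : WithTop ℕ∞) ≤ ∞ := by simp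
  obtain ⟨L₁, hL₁, ρ₁, hρ₁, h₁⟩ := exists_norm_sub_le_of_contDiffAt
    ((eventually_contDiffAt_localMul I G).self_of_nhds.of_le one)
  obtain ⟨L₂, hL₂, ρ₂, hρ₂, h₂⟩ := exists_norm_sub_le_of_contDiffAt
    ((eventually_contDiffAt_localConj I G).self_of_nhds.of_le one)
  obtain ⟨L₃, hL₃, ρ₃, hρ₃, h₃⟩ := exists_norm_sub_le_of_contDiffAt
    ((eventually_contDiffAt_localDiv I G).self_of_nhds.of_le one)
  obtain ⟨ρ₄, hρ₄, h₄⟩ := Metric.eventually_nhds_iff.1 ((eventually_unitParam_localMul I G).and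
    ((eventually_unitParam_localConj I G).and (eventually_unitParam_localDiv I G)))
  obtain ⟨ρ₅, hρ₅, h₅⟩ := Metric.eventually_nhds_iff.1 ((eventually_contMDiffAt_unitParam I G).and
    (eventually_localMul_zero_right I G))
  set ρ := min ρ₁ (min ρ₂ (min ρ₃ (min ρ₄ ρ₅))) with hρ
  refine ⟨max L₁ (max L₂ L₃), by positivity, ρ, by positivity, fun a b ha hb => ?_⟩
  have hm {a b : E} (ha : ‖a‖ < ρ) (hb : ‖b‖ < ρ) : dist ((a, b) : E × E) 0 < ρ := by
    rw [dist_zero_right]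
    exact max_lt ha hb
  have h0 : ‖(0 : E)‖ < ρ := by rw [norm_zero]; exact (norm_nonneg a).trans_lt ha
  have r₁ : ρ ≤ ρ₁ := min_le_left _ _
  have r₂ : ρ ≤ ρ₂ := (min_le_right _ _).trans (min_le_left _ _)
  have r₃ : ρ ≤ ρ₃ := ((min_le_right _ _).trans (min_le_right _ _)).trans (min_le_left _ _)
  have r₄₅ : ρ ≤ min ρ₄ ρ₅ :=
    ((min_le_right _ _).trans (min_le_right _ _)).trans (min_le_right _ _)
  have r₄ : ρ ≤ ρ₄ := r₄₅.trans (min_le_left _ _)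
  have r₅ : ρ ≤ ρ₅ := r₄₅.trans (min_le_right _ _)
  obtain ⟨k1, k2, k3⟩ := h₄ ((hm ha hb).trans_le r₄)
  obtain ⟨k4, k5⟩ := h₅ (y := a) (by rw [dist_zero_right]; exact ha.trans_le r₅)
  refine ⟨k4, k1, k2, k3, ?_, ?_, ?_⟩
  -- Each estimate is a Lipschitz bound against a point where the value is known: `(a, 0)` for
  -- product and conjugation, `(b, b)` for division.
  · have := h₁ (a, b) ((hm ha hb).trans_le r₁) (a, 0) ((hm ha h0).trans_le r₁)
    rw [k5] at this
    have e : ((a, b) : E × E) - (a, 0) = (0, b) := by simp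
    rw [e] at this
    have e' : ‖((0 : E), b)‖ = ‖b‖ := by simp [Prod.norm_def]
    rw [e'] at this
    calc ‖localMul I G (a, b)‖ = ‖a + (localMul I G (a, b) - a)‖ := by rw [add_sub_cancel]
      _ ≤ ‖a‖ + ‖localMul I G (a, b) - a‖ := norm_add_le _ _
      _ ≤ ‖a‖ + L₁ * ‖b‖ := by gcongr
      _ ≤ _ := by gcongr; exact le_max_left _ _
  · have := h₂ (a, b) ((hm ha hb).trans_le r₂) (a, 0) ((hm ha h0).trans_le r₂)
    rw [localConj_zero_right, sub_zero] at this
    have e : ((a, b) : E × E) - (a, 0) = (0, b) := by simp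
    rw [e] at this
    have e' : ‖((0 : E), b)‖ = ‖b‖ := by simp [Prod.norm_def]
    rw [e'] at this
    refine this.trans ?_
    gcongr
    exact (le_max_left _ _).trans (le_max_right _ _)
  · have := h₃ (a, b) ((hm ha hb).trans_le r₃) (b, b) ((hm hb hb).trans_le r₃)
    rw [localDiv_self, sub_zero] at this
    have e : ((a, b) : E × E) - (b, b) = (a - b, 0) := by simp
    rw [e] at this
    have e' : ‖(a - b, (0 : E))‖ = ‖a - b‖ := by simp [Prod.norm_def]
    rw [e'] at this
    refine this.trans ?_
    gcongr
    exact (le_max_right _ _).trans (le_max_right _ _)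

variable {G}

/-- The velocities of sequences in a closed subgroup converging to the unit belong to the Lie
algebra of the subgroup. -/
theorem mem_subgroupLieAlgebra_of_tendsto [FiniteDimensional ℝ E] {H : Subgroup G}
    (hH : IsClosed (H : Set G)) {u : ℕ → E} (hu : Tendsto u atTop (𝓝 0)) (hne : ∀ n, u n ≠ 0)
    (huH : ∀ n, unitParam I G (u n) ∈ H) {Y : E}
    (hY : Tendsto (fun n => ‖u n‖⁻¹ • u n) atTop (𝓝 Y)) :
    (Y : GroupLieAlgebra I G) ∈ subgroupLieAlgebra I H := by
  have : CompleteSpace E := FiniteDimensional.complete ℝ E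
  obtain ⟨x, δ, hδ, hx0, hxY, hxs, hxm⟩ := exists_local_oneParameterSubgroup
    (eventually_contDiffAt_localMul I G) (eventually_localMul_zero_right I G)
    (eventually_localMul_zero_left I G) (eventually_localMul_assoc I G) Y
  obtain ⟨L, hL, ρ, hρ, est⟩ := exists_local_estimates I G
  have hxc : Tendsto x (𝓝 0) (𝓝 0) := by
    have := hxY.continuousAt
    rwa [ContinuousAt, hx0] at this
  obtain ⟨τ, hτ, hτδ, hxρ⟩ : ∃ τ > 0, τ < δ ∧ ∀ t, |t| ≤ τ → ‖x t‖ < ρ := by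
    have h1 : ∀ᶠ t in 𝓝 (0 : ℝ), ‖x t‖ < ρ := by
      have := hxc.norm
      rw [norm_zero] at this
      exact this.eventually_lt_const hρ
    obtain ⟨η, hη, h2⟩ := Metric.eventually_nhds_iff.1 h1
    refine ⟨min η δ / 2, by positivity, ?_, fun t ht => h2 ?_⟩
    · have := min_le_right η δ
      linarith
    · rw [Real.dist_eq, sub_zero]
      have := min_le_left η δ
      have : 0 < min η δ := by positivity
      linarith
  set γ : ℝ → G := fun t => unitParam I G (x t) with hγ
  have γ0 : γ 0 = 1 := by simp [hγ, hx0]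
  have mem {t : ℝ} (ht : |t| ≤ τ) : t ∈ Ioo (-δ) δ := abs_lt.1 (ht.trans_lt hτδ)
  have γm {s t : ℝ} (hs : |s| ≤ τ) (ht : |t| ≤ τ) : γ (s + t) = γ s * γ t := by
    simp only [hγ]
    rw [hxm s (mem hs) t (mem ht)]
    exact (est _ _ (hxρ s hs) (hxρ t ht)).2.1
  have xs {t : ℝ} (ht : |t| ≤ τ) : ContDiffAt ℝ ∞ x t :=
    hxs.contDiffAt (isOpen_Ioo.mem_nhds (mem ht))
  have es {t : ℝ} (ht : |t| ≤ τ) : ContMDiffAt 𝓘(ℝ, E) I ∞ (unitParam I G) (x t) :=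
    (est _ _ (hxρ t ht) (hxρ t ht)).1
  -- powers of the elements of the sequence approximate the one-parameter subgroup
  have step {v : E} {ε : ℝ} (hε : 0 < ε) (hετ : ε ≤ τ) (hv : ‖v‖ < ρ) {R : ℝ}
      (hR : R = ‖v - x ε‖) (r1 : L * R < ρ) (r2 : L * (L * R) < ρ)
      (r3 : τ / ε * (L * (L * (L * R))) < ρ) (k : ℕ) (hk : k * ε ≤ τ) :
      ∃ w : E, ‖w‖ ≤ k * (L * (L * (L * R))) ∧
        unitParam I G v ^ k = unitParam I G w * γ (k * ε) := by
    have hR0 : 0 ≤ R := hR ▸ norm_nonneg _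
    have abs_ε : |ε| ≤ τ := by rwa [abs_of_pos hε]
    induction k with
    | zero => exact ⟨0, by simp, by simp [γ0]⟩
    | succ k ih =>
      push_cast at hk
      have hk' : k * ε ≤ τ := by linarith
      have abs_k : |k * ε| ≤ τ := by rwa [abs_of_nonneg (by positivity)]
      obtain ⟨w, hw, e⟩ := ih hk'
      have hwρ : ‖w‖ < ρ := by
        refine (hw.trans ?_).trans_lt r3
        gcongr
        rwa [le_div_iff₀ hε]
      -- With `d = v γ(ε)⁻¹`, `v^(k+1) = w γ(kε) d γ(ε) = (w · γ(kε) d γ(kε)⁻¹) γ((k+1)ε)`.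
      -- Division, conjugation and product each cost a factor `L`, so one more power adds at most
      -- `L³ R` to the error.
      obtain ⟨-, -, -, d1, -, -, d2⟩ := est v (x ε) hv (hxρ ε abs_ε)
      rw [← hR] at d2
      obtain ⟨-, -, c1, -, -, c2, -⟩ := est (x (k * ε)) (localDiv I G (v, x ε)) (hxρ _ abs_k)
        (d2.trans_lt r1)
      have c3 : ‖localConj I G (x (k * ε), localDiv I G (v, x ε))‖ ≤ L * (L * R) :=
        c2.trans (by gcongr)
      obtain ⟨-, p1, -, -, p2, -, -⟩ := est w _ hwρ (c3.trans_lt r2)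
      refine ⟨_, p2.trans ?_, ?_⟩
      · push_cast
        rw [add_mul, one_mul]
        gcongr
      · rw [pow_succ, e, p1, c1, d1]
        push_cast
        rw [add_mul, one_mul, γm abs_k abs_ε]
        simp only [hγ]
        group
  have hε0 (n : ℕ) : 0 < ‖u n‖ := norm_pos_iff.2 (hne n)
  have hε : Tendsto (fun n => ‖u n‖) atTop (𝓝 0) := by simpa using hu.norm
  set R : ℕ → ℝ := fun n => ‖u n - x ‖u n‖‖ with hR
  -- `R n = o(‖u n‖)`, since `u n` and `x ‖u n‖`, divided by `‖u n‖`, both tend to `Y`. This beats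
  -- the roughly `t / ‖u n‖` accumulated errors.
  have hRε : Tendsto (fun n => ‖u n‖⁻¹ * R n) atTop (𝓝 0) := by
    have h1 : Tendsto (fun n => ‖u n‖⁻¹ • (x ‖u n‖)) atTop (𝓝 Y) := by
      have h2 := hasDerivAt_iff_tendsto_slope_zero.1 hxY
      have h3 : Tendsto (fun n => ‖u n‖) atTop (𝓝[≠] 0) :=
        tendsto_nhdsWithin_iff.2 ⟨hε, Eventually.of_forall fun n => (hε0 n).ne'⟩
      simpa [hx0, Function.comp_def] using h2.comp h3
    have h4 := (hY.sub h1).norm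
    rw [sub_self, norm_zero] at h4
    refine h4.congr fun n => ?_
    rw [← smul_sub, norm_smul, norm_inv, norm_norm]
  have hR0 : Tendsto R atTop (𝓝 0) := by
    have := hε.mul hRε
    rw [zero_mul] at this
    refine this.congr fun n => ?_
    rw [mul_inv_cancel_left₀ (hε0 n).ne']
  have pos {t : ℝ} (ht0 : 0 ≤ t) (ht : t ≤ τ) : γ t ∈ H := by
    -- With this exponent `k n * ‖u n‖ → t`, so the powers `unitParam I G (u n) ^ k n` in `H` tend
    -- to `γ t`, which lies in `H` by closedness.
    set k : ℕ → ℕ := fun n => ⌊t / ‖u n‖⌋₊ with hk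
    have hk1 (n : ℕ) : k n * ‖u n‖ ≤ t := by
      rw [← le_div_iff₀ (hε0 n)]
      exact Nat.floor_le (by have := hε0 n; positivity)
    have hk2 (n : ℕ) : t - ‖u n‖ ≤ k n * ‖u n‖ := by
      have := (Nat.lt_floor_add_one (t / ‖u n‖)).le
      rw [div_le_iff₀ (hε0 n), add_mul, one_mul] at this
      linarith
    have hkt : Tendsto (fun n => k n * ‖u n‖) atTop (𝓝 t) := by
      have h1 : Tendsto (fun n => t - ‖u n‖) atTop (𝓝 t) := by
        simpa using tendsto_const_nhds.sub hε
      exact tendsto_of_tendsto_of_tendsto_of_le_of_le h1 tendsto_const_nhds hk2 hk1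
    have lim (c : ℝ) : Tendsto (fun n => c * R n) atTop (𝓝 0) := by
      simpa using hR0.const_mul c
    have lim3 : Tendsto (fun n => τ / ‖u n‖ * (L * (L * (L * R n)))) atTop (𝓝 0) := by
      have := hRε.const_mul (τ * L * L * L)
      rw [mul_zero] at this
      exact this.congr fun n => by ring
    have ev : ∀ᶠ n in atTop, ∃ w : E, ‖w‖ ≤ k n * (L * (L * (L * R n))) ∧
        unitParam I G (u n) ^ k n = unitParam I G w * γ (k n * ‖u n‖) := by
      filter_upwards [hε.eventually_lt_const hτ, hε.eventually_lt_const hρ,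
        (lim L).eventually_lt_const hρ, (lim (L * L)).eventually_lt_const hρ,
        lim3.eventually_lt_const hρ] with n e1 e2 e3 e4 e5
      exact step (hε0 n) e1.le e2 rfl e3 (by rwa [← mul_assoc]) e5 (k n) ((hk1 n).trans ht)
    have hw : ∃ w : ℕ → E, ∀ᶠ n in atTop, ‖w n‖ ≤ k n * (L * (L * (L * R n))) ∧
        unitParam I G (u n) ^ k n = unitParam I G (w n) * γ (k n * ‖u n‖) := by
      classical
      -- The default `0` is harmless: it is used for only finitely many `n`.
      refine ⟨fun n => if h : _ then (Classical.choose (p := fun w : E =>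
        ‖w‖ ≤ k n * (L * (L * (L * R n))) ∧
        unitParam I G (u n) ^ k n = unitParam I G w * γ (k n * ‖u n‖)) h) else 0, ?_⟩
      filter_upwards [ev] with n hn
      rw [dif_pos hn]
      exact Classical.choose_spec hn
    obtain ⟨w, hw⟩ := hw
    have hw0 : Tendsto w atTop (𝓝 0) := by
      refine squeeze_zero_norm' ?_ lim3
      filter_upwards [hw] with n hn
      refine hn.1.trans ?_
      have := hε0 n
      gcongr
      rw [le_div_iff₀ this]
      exact (hk1 n).trans ht
    have abs_t : |t| ≤ τ := by rwa [abs_of_nonneg ht0]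
    have hγt : Tendsto γ (𝓝 t) (𝓝 (γ t)) :=
      ((es abs_t).continuousAt.comp (xs abs_t).continuousAt)
    have : IsTopologicalGroup G := topologicalGroup_of_lieGroup I ∞
    have hlim := ((tendsto_unitParam I G).comp hw0).mul (hγt.comp hkt)
    rw [one_mul] at hlim
    refine hH.mem_of_tendsto hlim ?_
    filter_upwards [hw] with n hn
    simp only [Function.comp]
    rw [← hn.2]
    exact H.pow_mem (huH n) _
  have all {t : ℝ} (ht : |t| ≤ τ) : γ t ∈ H := by
    rcases le_total 0 t with h | h
    · exact pos h (by rwa [abs_of_nonneg h] at ht)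
    · have h1 : γ (-t) ∈ H := pos (by linarith) (by rwa [abs_of_nonpos h] at ht)
      have h2 := γm ht (by rwa [abs_neg] : |-t| ≤ τ)
      rw [add_neg_cancel, γ0] at h2
      rw [eq_inv_of_mul_eq_one_left h2.symm]
      exact H.inv_mem h1
  -- Membership in `𝔥` asks for a curve on all of `ℝ`, while `γ` is controlled only on `[-τ, τ]`.
  -- The reparametrisation `ψ` stays in that interval, with `ψ(0) = 0` and `ψ'(0) = 1`.
  set ψ : ℝ → ℝ := fun t => τ * Real.sin (t / τ) with hψ
  have ψs : ContDiff ℝ ∞ ψ := contDiff_const.mul (Real.contDiff_sin.comp (contDiff_id.div_const τ))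
  have ψτ (t : ℝ) : |ψ t| ≤ τ := by
    rw [hψ, abs_mul, abs_of_pos hτ]
    exact mul_le_of_le_one_right hτ.le (Real.abs_sin_le_one _)
  have ψ0 : ψ 0 = 0 := by simp [hψ]
  have ψd : HasDerivAt ψ 1 0 := by
    have := ((hasDerivAt_id (0 : ℝ)).div_const τ).sin.const_mul τ
    simpa [hψ, hτ.ne'] using this
  have c0 : γ (ψ 0) = 1 := by rw [ψ0, γ0]
  refine ⟨fun t => γ (ψ t), c0, fun t => ?_, fun t => all (ψτ t), ?_⟩
  · exact ContMDiffAt.comp (g := unitParam I G) (f := fun t => x (ψ t)) (I' := 𝓘(ℝ, E)) t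
      (es (ψτ t)) ((xs (ψτ t)).comp t ψs.contDiffAt).contMDiffAt
  · have h1 : HasFDerivAt (fun t => x (ψ t)) (ContinuousLinearMap.toSpanSingleton ℝ Y) 0 := by
      rw [← ψ0] at hxY
      have := (hxY.scomp (0 : ℝ) ψd).hasFDerivAt
      simpa [Function.comp_def] using this
    have h2 : HasMFDerivAt 𝓘(ℝ, E) I (unitParam I G) (x (ψ 0)) (ContinuousLinearMap.id ℝ E) := by
      rw [ψ0, hx0]
      exact hasMFDerivAt_unitParam I G
    have h3 := (h2.comp (0 : ℝ) h1.hasMFDerivAt).mfderiv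
    refine (congrArg (fun L : ℝ →L[ℝ] E => L 1) h3).trans ?_
    exact one_smul ℝ Y

end ClosedSubgroup

/-! ### A closed subgroup near the unit, and the connected case -/

section ClosedSubgroup

open Filter Topology Set

variable {E : Type*} [NormedAddCommGroup E] [NormedSpace ℝ E]
  {M : Type*} [TopologicalSpace M] (I : ModelWithCorners ℝ E M)
  {G : Type*} [TopologicalSpace G] [ChartedSpace M G] [Group G] [LieGroup I ∞ G] [I.Boundaryless]
  [FiniteDimensional ℝ E]

/-- A closed subgroup meets a transversal to its Lie algebra only at the unit. -/
theorem eventually_eq_zero_of_mem_of_disjoint {H : Subgroup G} (hH : IsClosed (H : Set G))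
    {𝔪 : Submodule ℝ E} (h𝔪 : ∀ Y ∈ 𝔪, (Y : GroupLieAlgebra I G) ∈ subgroupLieAlgebra I H → Y = 0) :
    ∀ᶠ y : 𝔪 in 𝓝 0, unitParam I G (y : E) ∈ H → y = 0 := by
  by_contra hcon
  rw [not_eventually] at hcon
  obtain ⟨u, hu, hp⟩ := exists_seq_forall_of_frequently hcon
  simp only [Classical.not_imp] at hp
  have hs (n : ℕ) : ‖u n‖⁻¹ • u n ∈ Metric.sphere (0 : 𝔪) 1 := by
    rw [mem_sphere_zero_iff_norm, norm_smul, norm_inv, norm_norm,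
      inv_mul_cancel₀ (norm_ne_zero_iff.2 (hp n).2)]
  -- A limit direction `Y` of the counterexamples is a unit vector of `𝔪` that also lies in `𝔥`,
  -- which is impossible.
  obtain ⟨Y, hY, φ, hφ, hlim⟩ := (isCompact_sphere (0 : 𝔪) 1).tendsto_subseq hs
  have hY0 : Y = 0 := by
    refine Subtype.ext (h𝔪 Y Y.2 ?_)
    refine mem_subgroupLieAlgebra_of_tendsto I hH (u := fun n => (u (φ n) : E)) ?_
      (fun n => by simpa using (hp (φ n)).2) (fun n => (hp (φ n)).1) ?_
    · exact (continuous_subtype_val.tendsto' (0 : 𝔪) (0 : E) rfl).comp (hu.comp hφ.tendsto_atTop)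
    · exact (continuous_subtype_val.tendsto Y).comp hlim
  rw [hY0, mem_sphere_zero_iff_norm, norm_zero] at hY
  exact zero_ne_one hY

omit [FiniteDimensional ℝ E] in
/-- Products of smooth curves in a subgroup, with prescribed velocities. -/
theorem exists_prod_curves {ι : Type*} [Fintype ι] {H K : Subgroup G}
    (hK : ∀ γ : ℝ → G, γ 0 = 1 → ContMDiff 𝓘(ℝ, ℝ) I ∞ γ → (∀ t, γ t ∈ H) → ∀ t, γ t ∈ K)
    (X : ι → E) (hX : ∀ i, (X i : GroupLieAlgebra I G) ∈ subgroupLieAlgebra I H) (s : Finset ι) :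
    ∃ P : (ι → ℝ) → G, ContMDiff 𝓘(ℝ, ι → ℝ) I ∞ P ∧ P 0 = 1 ∧ (∀ t, P t ∈ K) ∧
      ∃ T : (ι → ℝ) →L[ℝ] E, HasFDerivAt (fun t => unitCoord I (P t)) T 0 ∧
        ∀ t, T t = ∑ i ∈ s, t i • X i := by
  classical
  induction s using Finset.induction_on with
  | empty =>
    exact ⟨fun _ => 1, contMDiff_const, rfl, fun _ => K.one_mem, 0, hasFDerivAt_const _ _, by simp⟩
  | insert i s hi ih =>
    obtain ⟨P, hP, hP0, hPK, T, hT, hTX⟩ := ih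
    obtain ⟨γ, γ0, hγ, γH, hγX⟩ := hX i
    have hproj : ContMDiff 𝓘(ℝ, ι → ℝ) 𝓘(ℝ, ℝ) ∞ (fun t : ι → ℝ => t i) :=
      (contDiff_apply ℝ ℝ i).contMDiff
    have hγi : ContMDiff 𝓘(ℝ, ι → ℝ) I ∞ (fun t : ι → ℝ => γ (t i)) := hγ.comp hproj
    have hdγ : HasFDerivAt (fun r => unitCoord I (γ r)) ((ContinuousLinearMap.id ℝ E).comp
        (mfderiv 𝓘(ℝ, ℝ) I γ 0 : ℝ →L[ℝ] E)) 0 := by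
      have hc : HasMFDerivAt I 𝓘(ℝ, E) (unitCoord I) (γ 0) (ContinuousLinearMap.id ℝ E) := by
        rw [γ0]
        exact hasMFDerivAt_unitCoord I
      exact (hc.comp (0 : ℝ) (hγ.mdifferentiable (by simp) 0).hasMFDerivAt).hasFDerivAt
    set D : ℝ →L[ℝ] E := (ContinuousLinearMap.id ℝ E).comp (mfderiv 𝓘(ℝ, ℝ) I γ 0 : ℝ →L[ℝ] E)
    have hD (r : ℝ) : D r = r • X i := by
      have h1 : D 1 = X i := hγX
      rw [← h1, ← map_smul, smul_eq_mul, mul_one]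
    have hd2 : HasFDerivAt (fun t : ι → ℝ => unitCoord I (γ (t i)))
        (D.comp (ContinuousLinearMap.proj i)) 0 :=
      HasFDerivAt.comp (g := fun r => unitCoord I (γ r)) (0 : ι → ℝ) hdγ (hasFDerivAt_apply i 0)
    have hm : HasFDerivAt (localMul I G) (fderiv ℝ (localMul I G) 0)
        ((fun t : ι → ℝ => (unitCoord I (P t), unitCoord I (γ (t i)))) 0) := by
      simp only [hP0, Pi.zero_apply, γ0, unitCoord_one]
      exact ((eventually_contDiffAt_localMul I G).self_of_nhds.differentiableAt
        (by simp)).hasFDerivAt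
    refine ⟨fun t => P t * γ (t i), hP.mul hγi, by simp [hP0, γ0],
      fun t => K.mul_mem (hPK t) (hK γ γ0 hγ γH _), _,
      (hm.comp (0 : ι → ℝ) (hT.prodMk hd2)).congr_of_eventuallyEq ?_, fun t => ?_⟩
    · have t1 : Tendsto P (𝓝 0) (𝓝 1) := hP0 ▸ hP.continuous.tendsto 0
      have t2 : Tendsto (fun t : ι → ℝ => γ (t i)) (𝓝 0) (𝓝 1) := by
        have := hγi.continuous.tendsto 0
        rwa [Pi.zero_apply, γ0] at this
      filter_upwards [t1.eventually (eventually_unitParam_unitCoord I),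
        t2.eventually (eventually_unitParam_unitCoord I)] with t h1 h2
      simp only [Function.comp, localMul, inUnitChart, h1, h2]
    · simp only [ContinuousLinearMap.comp_apply, ContinuousLinearMap.prod_apply]
      rw [fderiv_mul_zero_apply (eventually_contDiffAt_localMul I G).self_of_nhds
        (eventually_localMul_zero_right I G) (eventually_localMul_zero_left I G), hTX,
        ContinuousLinearMap.proj_apply, hD, Finset.sum_insert hi, add_comm]

/-- A neighbourhood of the unit in a closed subgroup `H` is contained in any subgroup containing
all smooth curves in `H` through the unit. -/
theorem eventually_mem_of_curve_mem {H K : Subgroup G} (hH : IsClosed (H : Set G)) (hKH : K ≤ H)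
    (hK : ∀ γ : ℝ → G, γ 0 = 1 → ContMDiff 𝓘(ℝ, ℝ) I ∞ γ → (∀ t, γ t ∈ H) → ∀ t, γ t ∈ K) :
    ∀ᶠ g in 𝓝 (1 : G), g ∈ H → g ∈ K := by
  have : CompleteSpace E := FiniteDimensional.complete ℝ E
  let 𝔥 : Submodule ℝ E := (subgroupLieAlgebra I H : Submodule ℝ (GroupLieAlgebra I G))
  obtain ⟨𝔪, h𝔪⟩ := Submodule.exists_isCompl 𝔥
  let b := Module.finBasis ℝ 𝔥
  obtain ⟨P, hP, hP0, hPK, T, hT, hTX⟩ := exists_prod_curves I hK (fun i => (b i : E))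
    (fun i => (b i).2) Finset.univ
  have hB := eventually_eq_zero_of_mem_of_disjoint I hH (𝔪 := 𝔪)
    fun Y hY hY' => (Submodule.disjoint_def.1 h𝔪.disjoint) Y hY' hY
  have t1 : Tendsto P (𝓝 0) (𝓝 1) := hP0 ▸ hP.continuous.tendsto 0
  have cP : ContDiffAt ℝ ∞ (fun t => unitCoord I (P t)) 0 := by
    rw [← contMDiffAt_iff_contDiffAt]
    have hc : ContMDiffAt I 𝓘(ℝ, E) ∞ (unitCoord I) (P 0) := by
      rw [hP0]
      exact (eventually_contMDiffAt_unitCoord I).self_of_nhds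
    exact hc.comp 0 hP.contMDiffAt
  -- `localMul I G ∘ A` expresses `(t, y) ↦ P(t) · y` in the chart. Its derivative `(t, y) ↦ ∑ tᵢ bᵢ
  -- + y` maps onto `𝔥 + 𝔪 = E`, so the map sends neighbourhoods of `0` onto neighbourhoods of `0`.
  set A : (Fin (Module.finrank ℝ 𝔥) → ℝ) × 𝔪 → E × E := fun p => (unitCoord I (P p.1), (p.2 : E))
    with hA
  have hA0 : A 0 = 0 := by simp [hA, hP0]
  have hAd : HasFDerivAt A ((T.comp (ContinuousLinearMap.fst ℝ _ _)).prod
      (𝔪.subtypeL.comp (ContinuousLinearMap.snd ℝ _ _))) 0 := by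
    refine HasFDerivAt.prodMk ?_ (𝔪.subtypeL.hasFDerivAt.comp _ hasFDerivAt_snd)
    exact HasFDerivAt.comp (g := fun t => unitCoord I (P t)) (0 : _ × 𝔪) hT hasFDerivAt_fst
  have hAs : ContDiffAt ℝ ∞ A 0 := by
    refine ContDiffAt.prodMk ?_ (𝔪.subtypeL.contDiff.contDiffAt.comp _ contDiffAt_snd)
    exact ContDiffAt.comp (g := fun t => unitCoord I (P t)) (0 : _ × 𝔪) cP contDiffAt_fst
  have hm := (eventually_contDiffAt_localMul I G).self_of_nhds
  have hFs : ContDiffAt ℝ ∞ (localMul I G ∘ A) 0 := ContDiffAt.comp 0 (by rwa [hA0]) hAs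
  have hFd : HasFDerivAt (localMul I G ∘ A) ((fderiv ℝ (localMul I G) 0).comp _) 0 :=
    HasFDerivAt.comp 0 (by rw [hA0]; exact (hm.differentiableAt (by simp)).hasFDerivAt) hAd
  have hF := (hFs.hasStrictFDerivAt' hFd (by simp)).map_nhds_eq_of_surj (by
    rw [LinearMap.range_eq_top]
    intro z
    obtain ⟨u, hu, v, hv, rfl⟩ := Submodule.mem_sup.1
      (show z ∈ 𝔥 ⊔ 𝔪 by rw [h𝔪.sup_eq_top]; trivial)
    refine ⟨(fun i => b.repr ⟨u, hu⟩ i, ⟨v, hv⟩), ?_⟩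
    refine (fderiv_mul_zero_apply hm (eventually_localMul_zero_right I G)
      (eventually_localMul_zero_left I G) _ _).trans ?_
    have h1 := congrArg (Subtype.val) (b.sum_repr ⟨u, hu⟩)
    simp only [Submodule.coe_sum, Submodule.coe_smul] at h1
    change T (fun i => b.repr ⟨u, hu⟩ i) + v = u + v
    rw [hTX, h1])
  have hF0 : (localMul I G ∘ A) 0 = 0 := by
    simp only [Function.comp, hA0]
    exact (eventually_localMul_zero_right I G).self_of_nhds
  rw [hF0] at hF
  have f1 : Tendsto (fun p : (Fin (Module.finrank ℝ 𝔥) → ℝ) × 𝔪 => p.1) (𝓝 0) (𝓝 0) :=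
    continuous_fst.tendsto' _ _ rfl
  have f2 : Tendsto (fun p : (Fin (Module.finrank ℝ 𝔥) → ℝ) × 𝔪 => p.2) (𝓝 0) (𝓝 0) :=
    continuous_snd.tendsto' _ _ rfl
  have tA : Tendsto A (𝓝 0) (𝓝 0) := by
    have := hAd.continuousAt
    rwa [ContinuousAt, hA0] at this
  have key : ∀ᶠ z in 𝓝 (0 : E), unitParam I G z ∈ H → unitParam I G z ∈ K := by
    rw [← hF, eventually_map]
    filter_upwards [f2.eventually hB, tA.eventually (eventually_unitParam_localMul I G),
      (t1.comp f1).eventually (eventually_unitParam_unitCoord I)] with p h1 h2 h3 h4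
    have e : unitParam I G ((localMul I G ∘ A) p) = P p.1 * unitParam I G (p.2 : E) := by
      refine h2.trans ?_
      exact congrArg (· * _) h3
    rw [e] at h4 ⊢
    -- If `P(t) · y ∈ H`, then the factor `y` is in `H`, hence trivial by transversality, and `P(t)
    -- ∈ K` remains.
    have h5 := (H.mul_mem_cancel_left (hKH (hPK p.1))).1 h4
    rw [h1 h5]
    simpa using hPK p.1
  filter_upwards [(tendsto_unitCoord I).eventually key, eventually_unitParam_unitCoord I]
    with g h1 h2
  rwa [h2] at h1

/-- A connected closed subgroup is generated by its smooth curves through the unit. -/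
theorem le_of_curve_mem_of_isConnected {H K : Subgroup G} (hH : IsClosed (H : Set G))
    (hc : IsConnected (H : Set G)) (hKH : K ≤ H)
    (hK : ∀ γ : ℝ → G, γ 0 = 1 → ContMDiff 𝓘(ℝ, ℝ) I ∞ γ → (∀ t, γ t ∈ H) → ∀ t, γ t ∈ K) :
    H ≤ K := by
  have : IsTopologicalGroup G := topologicalGroup_of_lieGroup I ∞
  have : ConnectedSpace H := isConnected_iff_connectedSpace.1 hc
  have hnhds : ((K.subgroupOf H : Subgroup H) : Set H) ∈ 𝓝 (1 : H) := by
    have h1 := (continuous_subtype_val.tendsto (1 : H)).eventually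
      (eventually_mem_of_curve_mem I hH hKH hK)
    filter_upwards [h1] with g hg
    exact hg g.2
  -- An open subgroup is also closed, hence everything in the connected group `H`.
  have hopen : IsOpen ((K.subgroupOf H : Subgroup H) : Set H) :=
    Subgroup.isOpen_of_mem_nhds _ hnhds
  have huniv := IsClopen.eq_univ ⟨Subgroup.isClosed_of_isOpen _ hopen, hopen⟩
    ⟨1, (K.subgroupOf H).one_mem⟩
  intro h hh
  have : (⟨h, hh⟩ : H) ∈ ((K.subgroupOf H : Subgroup H) : Set H) := by rw [huniv]; trivial
  exact this

end ClosedSubgroup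

end PoissonLie

theorem mainTheorem5
    {E : Type*} [NormedAddCommGroup E] [NormedSpace ℝ E] [FiniteDimensional ℝ E]
    {M : Type*} [TopologicalSpace M] (I : ModelWithCorners ℝ E M) [I.Boundaryless]
    {G : Type*} [TopologicalSpace G] [ChartedSpace M G] [Group G] [LieGroup I ∞ G]
    (π : ∀ g : G, ⋀[ℝ]^2 (TangentSpace I g)) (hπ : PoissonLie.IsPoissonLie I π)
    (r : ⋀[ℝ]^2 (GroupLieAlgebra I G)) (hr : ∀ g : G, π g = PoissonLie.rMatrixField I r g)
    (H : Subgroup G) (hH : IsClosed (H : Set G)) (hcoiso : PoissonLie.IsCoisotropic I H π)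
    (σ : G) :
    (PoissonLie.IsCoisotropic I H (PoissonLie.rightTranslate I π σ) →
      ∀ X ∈ PoissonLie.subgroupLieAlgebra I H,
        PoissonLie.adBivector I X (PoissonLie.AdBivector I σ⁻¹ r) ∈
          PoissonLie.wedgeTop (PoissonLie.subgroupLieAlgebra I H)) ∧
    (IsConnected (H : Set G) →
      (PoissonLie.IsCoisotropic I H (PoissonLie.rightTranslate I π σ) ↔
        ∀ X ∈ PoissonLie.subgroupLieAlgebra I H,
          PoissonLie.adBivector I X (PoissonLie.AdBivector I σ⁻¹ r) ∈
            PoissonLie.wedgeTop (PoissonLie.subgroupLieAlgebra I H))) := by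
  obtain rfl : π = PoissonLie.rMatrixField I r := funext hr
  rw [PoissonLie.isCoisotropic_rightTranslate_iff]
  refine ⟨fun h X hX => PoissonLie.adBivector_mem_wedgeTop h hX, fun hc =>
    ⟨fun h X hX => PoissonLie.adBivector_mem_wedgeTop h hX, fun hs h hh => ?_⟩⟩
  exact (PoissonLie.le_of_curve_mem_of_isConnected I hH hc
    (K := PoissonLie.stabilizerMod H (PoissonLie.AdBivector I σ⁻¹ r)) (fun _ hk => hk.1)
    (fun _ h0 hγ hγH => PoissonLie.curve_mem_stabilizerMod hs h0 hγ hγH) hh).2
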